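/- Let $(W,S)$ be a Coxeter system with $W$ finite and length function $\ell$, let $\Gamma$ be a totally ordered abelian group (with order compatible with addition), and let $L\colon W\to\Gamma$ be a weight function, i.e. $L(ww')=L(w)+L(w')$ whenever $\ell(ww')=\ell(w)+\ell(w')$, such that $L(s)>0$ for all $s\in S$. Let $R\subseteq\mathbb{C}$ be a subring containing $2\cos(2\pi/m_{st})$ for all $s,t\in S$, where $m_{st}$ is the order of $st$. Let $F$ be the field of fractions of $R$, let $A=R[\Gamma]$ be the group ring with basis $\{\varepsilon^g\mid g\in\Gamma\}$, and let $K$ be the field of fractions of $A$. Let $\mathbf{H}$ be the generic Iwahori--Hecke algebra over $A$: the associative algebra, free over $A$ with basis $\{T_w\mid w\in W\}$, with identity $T_1$ and $$T_sT_w=\begin{cases}T_{sw}&\text{if }\ell(sw)>\ell(w),\\ T_{sw}+(\varepsilon^{L(s)}-\varepsilon^{-L(s)})T_w&\text{if }\ell(sw)<\ell(w)\end{cases}\qquad(s\in S,\ w\in W),$$ and let $\mathbf{H}_K=K\otimes_A\mathbf{H}$. Every non-zero $x\in K$ can be written as $x=r_x\varepsilon^{g_x}(1+p)/(1+q)$ with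 unique $0\ne r_x\in F$ and $g_x\in\Gamma$, where $p,q$ are $F$-linear combinations of terms $\varepsilon^g$ with $g>0$. Let $\mathcal{O}=\{0\}\cup\{x\mid g_x\ge 0\}$ and $\mathfrak{p}=\{0\}\cup\{x\mid g_x>0\}$; the constant term of $x\in\mathcal{O}$ is the unique $r\in F$ with $x-r\in\mathfrak{p}$. Let $\{E^\lambda\mid\lambda\in\Lambda\}$ be a complete set of representatives of the irreducible complex representations of $W$, and $d_\lambda=\dim E^\lambda$. For each $\lambda\in\Lambda$ let $\rho^\lambda\colon\mathbf{H}_K\to M_{d_\lambda}(K)$ be an irreducible matrix representation that corresponds to $E^\lambda$, i.e. for all $w\in W$ we have $\operatorname{trace}\rho^\lambda(T_w)\in A$ and $\theta_1(\operatorname{trace}\rho^\lambda(T_w))=\operatorname{trace}(w,E^\lambda)$, where $\theta_1\colon A\to R$ is the $R$-linear ring homomorphism with $\theta_1(\varepsilon^g)=1$ for all $g$. Let $\boldsymbol{c}_\lambda\in K$ be defined by $\sum_{w\in W}\operatorname{trace}\rho^\lambda(T_w)\operatorname{trace}\rho^\lambda(T_{w^{-1}})=d_\lambda\boldsymbol{c}_\lambda$,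 and let $\boldsymbol{a}_\lambda\in\Gamma$, $0\ne f_\lambda\in F$ be determined by $$\boldsymbol{c}_\lambda=f_\lambda\varepsilon^{-2\boldsymbol{a}_\lambda}+\text{an $F$-linear combination of terms }\varepsilon^g\text{ with }g>-2\boldsymbol{a}_\lambda .$$ Assume that every $\rho^\lambda$ is balanced, i.e. $\varepsilon^{\boldsymbol{a}_\lambda}\rho^\lambda_{ij}(T_w)\in\mathcal{O}$ for all $w\in W$ and all $i,j$, and let $c_{w,\lambda}^{ij}\in F$ be the constant term of $(-1)^{\ell(w)}\varepsilon^{\boldsymbol{a}_\lambda}\rho^\lambda_{ij}(T_w)$. For $w,x,y,z\in W$ set $$\tilde\gamma_{x,y,z}=\sum_{\lambda\in\Lambda}\sum_{1\le i,j,k\le d_\lambda}f_\lambda^{-1}c_{x,\lambda}^{ij}c_{y,\lambda}^{jk}c_{z,\lambda}^{ki},\qquad \tilde n_w=\sum_{\lambda\in\Lambda}\sum_{1\le i\le d_\lambda}f_\lambda^{-1}c_{w^{-1},\lambda}^{ii},$$ and $\tilde{\mathcal{D}}=\{w\in W\mid\tilde n_w\ne 0\}$. Let $\tilde{\mathbf{J}}$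 be the $F$-vector space with basis $\{t_w\mid w\in W\}$ and the bilinear product given by $t_xt_y=\sum_{z\in W}\tilde\gamma_{x,y,z^{-1}}\,t_z$. Then $\tilde{\mathbf{J}}$ is an associative algebra with identity element $\sum_{w\in\tilde{\mathcal{D}}}\tilde n_w t_w$. -/

import Mathlib

namespace IwahoriHecke

section Exchange

variable {B W : Type*} [Group W] {M : CoxeterMatrix B} (cs : CoxeterSystem M W)

theorem end_mul_apply {α : Type*} (f g : Function.End α) (p : α) : (f * g) p = f (g p) := rfl

open Classical in
/-- The involution `(t, e) ↦ (s t s, e + [t = s])` of `W × ℤ/2` attached to a simple reflection. -/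
noncomputable def parityOp (i : B) : Function.End (W × ZMod 2) :=
  fun p => (cs.simple i * p.1 * cs.simple i, p.2 + if p.1 = cs.simple i then 1 else 0)

open Classical in
theorem parityOp_mul_pow (i j : B) (n : ℕ) (p : W × ZMod 2) :
    ((parityOp cs i * parityOp cs j) ^ n) p =
      ((cs.simple i * cs.simple j) ^ n * p.1 * ((cs.simple i * cs.simple j) ^ n)⁻¹,
        p.2 + ∑ k ∈ Finset.range (2 * n),
          if p.1 = cs.simple j * (cs.simple i * cs.simple j) ^ k then 1 else 0) := by
  set c := cs.simple i * cs.simple j with hc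
  have hci : c⁻¹ = cs.simple j * cs.simple i := by simp [hc]
  have hconj : ∀ k : ℕ, (c ^ k)⁻¹ * cs.simple j = cs.simple j * c ^ k := by
    intro k
    induction k with
    | zero => simp
    | succ k ih =>
      nth_rw 1 [pow_succ]
      rw [mul_inv_rev, mul_assoc, ih, ← mul_assoc, hci, pow_succ']
      simp [hc, mul_assoc]
  induction n with
  | zero => simp; rfl
  | succ n ih =>
    rw [pow_succ', end_mul_apply, ih, end_mul_apply]
    refine Prod.ext ?_ ?_
    · simp only [parityOp, pow_succ' c n, mul_inv_rev, hci]
      simp only [hc, mul_assoc]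
    · have e1 : (c ^ n * p.1 * (c ^ n)⁻¹ = cs.simple j) ↔ p.1 = cs.simple j * c ^ (2 * n) := by
        rw [mul_inv_eq_iff_eq_mul, ← eq_inv_mul_iff_mul_eq, ← mul_assoc, hconj, mul_assoc,
          ← pow_add, two_mul]
      have e2 : (cs.simple j * (c ^ n * p.1 * (c ^ n)⁻¹) * cs.simple j = cs.simple i) ↔
          p.1 = cs.simple j * c ^ (2 * n + 1) := by
        have h1 : c ^ (2 * n + 1) = c ^ n * c * c ^ n := by
          rw [← pow_succ, ← pow_add]; congr 1; ring
        have h2 : cs.simple j * (c ^ n * c * c ^ n) =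
            (c ^ n)⁻¹ * (cs.simple j * cs.simple i * cs.simple j) * c ^ n := by
          rw [← mul_assoc, ← mul_assoc, ← hconj]
          simp only [hc, mul_assoc]
        rw [h1, h2]
        constructor
        · intro h
          rw [← h]
          simp [mul_assoc]
        · intro h
          rw [h]
          simp [mul_assoc]
      simp only [parityOp]
      rw [show 2 * (n + 1) = 2 * n + 1 + 1 by ring, Finset.sum_range_succ, Finset.sum_range_succ]
      simp only [e1, e2]
      ring

theorem parityOp_isLiftable : M.IsLiftable (parityOp cs) := by
  classical
  intro i j
  funext p
  rw [parityOp_mul_pow, cs.simple_mul_simple_pow, two_mul, Finset.sum_range_add]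
  simp only [pow_add, cs.simple_mul_simple_pow, one_mul]
  refine Prod.ext (by simp; rfl) ?_
  have : ∀ x : ZMod 2, x + x = 0 := by decide
  rw [this, add_zero]
  rfl

/-- The action of `W` on `W × ℤ/2` that counts inversions modulo two. -/
noncomputable def parityHom : W →* Function.End (W × ZMod 2) :=
  cs.lift ⟨parityOp cs, parityOp_isLiftable cs⟩

open Classical in
theorem parityHom_wordProd (ω : List B) (p : W × ZMod 2) :
    parityHom cs (cs.wordProd ω) p =
      (cs.wordProd ω * p.1 * (cs.wordProd ω)⁻¹, p.2 + ((cs.rightInvSeq ω).count p.1 : ZMod 2)) := by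
  induction ω with
  | nil => simp; rfl
  | cons i ω ih =>
    rw [cs.wordProd_cons, map_mul, end_mul_apply, ih, parityHom,
      cs.lift_apply_simple]
    refine Prod.ext (by simp [parityOp, mul_assoc]) ?_
    have e : (cs.wordProd ω * p.1 * (cs.wordProd ω)⁻¹ = cs.simple i) ↔
        (cs.wordProd ω)⁻¹ * cs.simple i * cs.wordProd ω = p.1 := by
      rw [mul_inv_eq_iff_eq_mul, ← eq_inv_mul_iff_mul_eq, eq_comm, mul_assoc]
    simp only [parityOp, CoxeterSystem.rightInvSeq, List.count_cons, e, beq_iff_eq]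
    push_cast
    ring

theorem mem_rightInvSeq_of_isRightDescent {ω : List B} {j : B}
    (h : cs.IsRightDescent (cs.wordProd ω) j) : cs.simple j ∈ cs.rightInvSeq ω := by
  classical
  by_contra hmem
  obtain ⟨ω', hω', hw⟩ := cs.exists_isReduced (cs.wordProd ω * cs.simple j)
  have h1 := parityHom_wordProd cs ω' (cs.simple j, 0)
  have h2 := parityHom_wordProd cs ω (cs.simple j, 1)
  rw [List.count_eq_zero_of_not_mem hmem] at h2
  rw [← hw, map_mul, end_mul_apply] at h1
  have h3 : parityHom cs (cs.simple j) (cs.simple j, 0) = (cs.simple j, 1) := by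
    rw [parityHom, cs.lift_apply_simple]
    simp [parityOp]
  rw [h3, h2] at h1
  have h4 := congrArg Prod.snd h1
  have h5 : cs.simple j ∈ cs.rightInvSeq ω' := by
    by_contra hn
    rw [List.count_eq_zero_of_not_mem hn] at h4
    simp at h4
  have h6 := (cs.isRightInversion_of_mem_rightInvSeq hω' h5).2
  rw [← hw, cs.simple_mul_simple_cancel_right] at h6
  exact absurd h (not_lt.mpr h6.le)

/-- If `sw > w`, `wt > w` and `swt < sw` for simple reflections `s, t`, then `sw = wt`. -/
theorem simple_mul_eq_mul_simple {w : W} {i j : B} (hi : cs.length w < cs.length (cs.simple i * w))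
    (hj : cs.length w < cs.length (w * cs.simple j))
    (hij : cs.length (cs.simple i * w * cs.simple j) < cs.length (cs.simple i * w)) :
    cs.simple i * w = w * cs.simple j := by
  obtain ⟨ω, hω, rfl⟩ := cs.exists_isReduced w
  have h : cs.simple j ∈ cs.rightInvSeq (i :: ω) := by
    apply mem_rightInvSeq_of_isRightDescent
    rw [cs.wordProd_cons]
    exact hij
  rw [CoxeterSystem.rightInvSeq, List.mem_cons] at h
  rcases h with h | h
  · rw [h]; simp [mul_assoc]
  · exact absurd (cs.isRightInversion_of_mem_rightInvSeq hω h).2 (not_lt.mpr hj.le)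

end Exchange

section Hecke

variable {B W : Type*} [Group W] {M : CoxeterMatrix B} {cs : CoxeterSystem M W}
  {Γ : Type*} [AddCommGroup Γ]

variable (cs Γ) in
/-- Weight functions: `L (w * w') = L w + L w'` whenever `ℓ (w * w') = ℓ w + ℓ w'`. -/
structure WeightFunction where
  /-- The underlying function. -/
  toFun : W → Γ
  map_mul : ∀ w w' : W, cs.length (w * w') = cs.length w + cs.length w' →
    toFun (w * w') = toFun w + toFun w'

variable (L : WeightFunction cs Γ) (R : Type*) [CommRing R]

/-- The element `v_s - v_s⁻¹` of `A = R[Γ]`, where `v_s = ε^{L(s)}`. -/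
noncomputable def heckeParam (i : B) : AddMonoidAlgebra R Γ :=
  .single (L.toFun (cs.simple i)) 1 - .single (-L.toFun (cs.simple i)) 1

variable {L} in
theorem weight_simple_eq {w : W} {i j : B} (hi : cs.length w < cs.length (cs.simple i * w))
    (h : cs.simple i * w = w * cs.simple j) :
    L.toFun (cs.simple i) = L.toFun (cs.simple j) := by
  have hl : cs.length (cs.simple i * w) = cs.length w + 1 := by
    rcases cs.length_simple_mul w i with h | h <;> omega
  have h1 := L.map_mul (cs.simple i) w (by rw [hl, cs.length_simple, add_comm])
  have h2 := L.map_mul w (cs.simple j) (by rw [← h, hl, cs.length_simple])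
  rw [h, h2, add_comm] at h1
  exact (add_right_cancel h1).symm

/-- The underlying free module, with basis indexed by `W`, of the generic Iwahori--Hecke algebra
`H = H_A(W, S, L)` over `A = R[Γ]`. -/
@[nolint unusedArguments]
def HeckeAlgebra (_L : WeightFunction cs Γ) (R : Type*) [CommRing R] : Type _ :=
  W →₀ AddMonoidAlgebra R Γ

namespace HeckeAlgebra

noncomputable instance : AddCommGroup (HeckeAlgebra L R) :=
  inferInstanceAs (AddCommGroup (W →₀ AddMonoidAlgebra R Γ))

noncomputable instance : Module (AddMonoidAlgebra R Γ) (HeckeAlgebra L R) :=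
  inferInstanceAs (Module (AddMonoidAlgebra R Γ) (W →₀ AddMonoidAlgebra R Γ))

/-- The standard basis `T_w`, `w ∈ W`. -/
noncomputable def basis : Module.Basis W (AddMonoidAlgebra R Γ) (HeckeAlgebra L R) :=
  ⟨LinearEquiv.refl _ _⟩

/-- The element `T_w`. -/
noncomputable def T (w : W) : HeckeAlgebra L R := basis L R w

open Classical in
/-- Left multiplication by `T_s`. -/
noncomputable def leftOp (i : B) : Module.End (AddMonoidAlgebra R Γ) (HeckeAlgebra L R) :=
  (basis L R).constr (AddMonoidAlgebra R Γ) fun w =>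
    if cs.length w < cs.length (cs.simple i * w) then T L R (cs.simple i * w)
    else T L R (cs.simple i * w) + heckeParam L R i • T L R w

open Classical in
/-- Right multiplication by `T_s`. -/
noncomputable def rightOp (i : B) : Module.End (AddMonoidAlgebra R Γ) (HeckeAlgebra L R) :=
  (basis L R).constr (AddMonoidAlgebra R Γ) fun w =>
    if cs.length w < cs.length (w * cs.simple i) then T L R (w * cs.simple i)
    else T L R (w * cs.simple i) + heckeParam L R i • T L R w

open Classical in
theorem leftOp_T (i : B) (w : W) : leftOp L R i (T L R w) =
    if cs.length w < cs.length (cs.simple i * w) then T L R (cs.simple i * w)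
    else T L R (cs.simple i * w) + heckeParam L R i • T L R w := by
  rw [leftOp, T, Module.Basis.constr_basis]
  rfl

open Classical in
theorem rightOp_T (i : B) (w : W) : rightOp L R i (T L R w) =
    if cs.length w < cs.length (w * cs.simple i) then T L R (w * cs.simple i)
    else T L R (w * cs.simple i) + heckeParam L R i • T L R w := by
  rw [rightOp, T, Module.Basis.constr_basis]
  rfl

theorem commute_leftOp_rightOp (i j : B) : Commute (leftOp L R i) (rightOp L R j) := by
  refine (basis L R).ext fun w => ?_
  change leftOp L R i (rightOp L R j (T L R w)) = rightOp L R j (leftOp L R i (T L R w))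
  have hA := cs.length_simple_mul w i
  have hB := cs.length_mul_simple w j
  have hC := cs.length_simple_mul (w * cs.simple j) i
  have hD := cs.length_mul_simple (cs.simple i * w) j
  rw [mul_assoc] at hD
  have hpar : cs.simple i * w = w * cs.simple j → heckeParam L R i = heckeParam L R j := by
    intro h
    unfold heckeParam
    have : L.toFun (cs.simple i) = L.toFun (cs.simple j) := by
      by_cases hlt : cs.length w < cs.length (cs.simple i * w)
      · exact weight_simple_eq hlt h
      · refine weight_simple_eq (w := cs.simple i * w) ?_ ?_
        · rw [cs.simple_mul_simple_cancel_left]; omega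
        · rw [h, cs.simple_mul_simple_cancel_right, ← h, cs.simple_mul_simple_cancel_left]
    rw [this]
  by_cases h1 : cs.length w < cs.length (cs.simple i * w) <;>
  by_cases h2 : cs.length w < cs.length (w * cs.simple j)
  · by_cases h3 : cs.length (w * cs.simple j) < cs.length (cs.simple i * (w * cs.simple j))
    · have h4 : cs.length (cs.simple i * w) < cs.length (cs.simple i * (w * cs.simple j)) := by
        omega
      simp [leftOp_T, rightOp_T, h1, h2, h3, h4, mul_assoc]
    · have h4 : ¬ cs.length (cs.simple i * w) < cs.length (cs.simple i * (w * cs.simple j)) := by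
        omega
      have h5 := simple_mul_eq_mul_simple cs h1 h2 (by rw [mul_assoc]; omega)
      simp [leftOp_T, rightOp_T, h1, h2, h3, h4, mul_assoc, hpar h5]
      rw [h5]
  · have h3 : cs.length (w * cs.simple j) < cs.length (cs.simple i * (w * cs.simple j)) := by
      omega
    have h4 : ¬ cs.length (cs.simple i * w) < cs.length (cs.simple i * (w * cs.simple j)) := by
      omega
    simp [leftOp_T, rightOp_T, h1, h2, h3, h4, mul_assoc]
  · have h3 : ¬ cs.length (w * cs.simple j) < cs.length (cs.simple i * (w * cs.simple j)) := by
      omega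
    have h4 : cs.length (cs.simple i * w) < cs.length (cs.simple i * (w * cs.simple j)) := by
      omega
    simp [leftOp_T, rightOp_T, h1, h2, h3, h4, mul_assoc]
  · by_cases h3 : cs.length (w * cs.simple j) < cs.length (cs.simple i * (w * cs.simple j))
    · have h4 : cs.length (cs.simple i * w) < cs.length (cs.simple i * (w * cs.simple j)) := by
        omega
      have h5 := simple_mul_eq_mul_simple cs (w := cs.simple i * w) (i := i) (j := j)
        (by rw [cs.simple_mul_simple_cancel_left]; omega) (by rw [mul_assoc]; exact h4)
        (by rw [cs.simple_mul_simple_cancel_left]; omega)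
      have h6 : cs.simple i * w = w * cs.simple j := by
        rw [cs.simple_mul_simple_cancel_left] at h5
        conv_rhs => rw [h5, cs.simple_mul_simple_cancel_right]
      have h7 := hpar h6
      simp [leftOp_T, rightOp_T, h1, h2, h3, h4, mul_assoc, h7]
      rw [h6]
    · have h4 : ¬ cs.length (cs.simple i * w) < cs.length (cs.simple i * (w * cs.simple j)) := by
        omega
      simp [leftOp_T, rightOp_T, h1, h2, h3, h4, mul_assoc]
      simp only [smul_smul, mul_comm]
      abel

theorem rightOp_prod_T_one {ω : List B} (hω : cs.IsReduced ω) :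
    ((ω.reverse.map (rightOp L R)).prod) (T L R 1) = T L R (cs.wordProd ω) := by
  induction ω using List.reverseRecOn with
  | nil => simp
  | append_singleton ω j ih =>
    have h1 : cs.IsReduced ω := by simpa using hω.take ω.length
    have h2 : cs.length (cs.wordProd ω) < cs.length (cs.wordProd ω * cs.simple j) := by
      have := hω.eq
      rw [cs.wordProd_append, cs.wordProd_singleton, List.length_append] at this
      rw [this, h1.eq]; simp
    rw [List.reverse_append, List.map_append, List.prod_append, Module.End.mul_apply, ih h1]
    simp [rightOp_T, h2, cs.wordProd_append]

theorem leftOp_prod_T_one {ω : List B} (hω : cs.IsReduced ω) :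
    ((ω.map (leftOp L R)).prod) (T L R 1) = T L R (cs.wordProd ω) := by
  induction ω with
  | nil => simp
  | cons i ω ih =>
    have h1 : cs.IsReduced ω := by simpa using hω.drop 1
    have h2 : cs.length (cs.wordProd ω) < cs.length (cs.simple i * cs.wordProd ω) := by
      have := hω.eq
      rw [cs.wordProd_cons, List.length_cons] at this
      rw [this, h1.eq]; simp
    rw [List.map_cons, List.prod_cons, Module.End.mul_apply, ih h1]
    simp [leftOp_T, h2, cs.wordProd_cons]

/-- An endomorphism commuting with all right multiplications is determined by its value at
`T_1`. -/
theorem end_eq_of_apply_one {f g : Module.End (AddMonoidAlgebra R Γ) (HeckeAlgebra L R)}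
    (hf : ∀ j, Commute f (rightOp L R j)) (hg : ∀ j, Commute g (rightOp L R j))
    (h : f (T L R 1) = g (T L R 1)) : f = g := by
  refine (basis L R).ext fun w => ?_
  change f (T L R w) = g (T L R w)
  obtain ⟨ω, hω, rfl⟩ := cs.exists_isReduced w
  rw [← rightOp_prod_T_one L R hω]
  have key : ∀ f : Module.End (AddMonoidAlgebra R Γ) (HeckeAlgebra L R),
      (∀ j, Commute f (rightOp L R j)) → Commute f ((ω.reverse.map (rightOp L R)).prod) := by
    intro f hf
    refine Commute.list_prod_right _ _ fun y hy => ?_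
    obtain ⟨j, -, rfl⟩ := List.mem_map.mp hy
    exact hf j
  rw [← Module.End.mul_apply, ← Module.End.mul_apply, (key f hf).eq, (key g hg).eq,
    Module.End.mul_apply, Module.End.mul_apply, h]

/-- Left multiplication by an element, as the `A`-linear map sending `T_w` to the product of the
left multiplications by `T_s` along a reduced word of `w`. -/
noncomputable def lmul :
    HeckeAlgebra L R →ₗ[AddMonoidAlgebra R Γ]
      Module.End (AddMonoidAlgebra R Γ) (HeckeAlgebra L R) :=
  (basis L R).constr (AddMonoidAlgebra R Γ) fun w =>
    ((cs.exists_isReduced w).choose.map (leftOp L R)).prod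

theorem lmul_T (w : W) : lmul L R (T L R w) =
    ((cs.exists_isReduced w).choose.map (leftOp L R)).prod := by
  rw [lmul, T, Module.Basis.constr_basis]

theorem lmul_apply_one (x : HeckeAlgebra L R) : lmul L R x (T L R 1) = x := by
  have : (LinearMap.applyₗ (T L R 1)).comp (lmul L R) = LinearMap.id := by
    refine (basis L R).ext fun w => ?_
    change lmul L R (T L R w) (T L R 1) = T L R w
    rw [lmul_T]
    have h := (cs.exists_isReduced w).choose_spec
    rw [leftOp_prod_T_one L R h.1, ← h.2]
  exact LinearMap.congr_fun this x

theorem commute_lmul_rightOp (x : HeckeAlgebra L R) (j : B) :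
    Commute (lmul L R x) (rightOp L R j) := by
  have hx : x ∈ Submodule.span (AddMonoidAlgebra R Γ) (Set.range (basis L R)) :=
    (basis L R).mem_span x
  induction hx using Submodule.span_induction with
  | zero => rw [map_zero]; exact Commute.zero_left _
  | add x y _ _ hx hy => rw [map_add]; exact hx.add_left hy
  | smul a x _ hx => rw [map_smul]; exact hx.smul_left a
  | mem x hx =>
    obtain ⟨w, rfl⟩ := hx
    change Commute (lmul L R (T L R w)) _
    rw [lmul_T]
    refine Commute.list_prod_left _ _ fun y hy => ?_
    obtain ⟨i, -, rfl⟩ := List.mem_map.mp hy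
    exact commute_leftOp_rightOp L R i j

noncomputable instance : Mul (HeckeAlgebra L R) := ⟨fun x y => lmul L R x y⟩

noncomputable instance : One (HeckeAlgebra L R) := ⟨T L R 1⟩

theorem mul_eq_lmul (x y : HeckeAlgebra L R) : x * y = lmul L R x y := rfl

theorem one_eq_T : (1 : HeckeAlgebra L R) = T L R 1 := rfl

theorem lmul_mul (x y : HeckeAlgebra L R) : lmul L R (x * y) = lmul L R x * lmul L R y := by
  refine end_eq_of_apply_one L R (commute_lmul_rightOp L R _)
    (fun j => (commute_lmul_rightOp L R x j).mul_left (commute_lmul_rightOp L R y j)) ?_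
  rw [lmul_apply_one, Module.End.mul_apply, lmul_apply_one, mul_eq_lmul]

theorem lmul_one : lmul L R 1 = 1 := by
  refine end_eq_of_apply_one L R (commute_lmul_rightOp L R _)
    (fun j => Commute.one_left _) ?_
  rw [lmul_apply_one, Module.End.one_apply, one_eq_T]

noncomputable instance : Ring (HeckeAlgebra L R) :=
  { (inferInstance : AddCommGroup (HeckeAlgebra L R)),
    (inferInstance : Mul (HeckeAlgebra L R)),
    (inferInstance : One (HeckeAlgebra L R)) with
    left_distrib := fun x y z => map_add (lmul L R x) y z
    right_distrib := fun x y z => by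
      rw [mul_eq_lmul, map_add, LinearMap.add_apply]; rfl
    zero_mul := fun x => by rw [mul_eq_lmul, map_zero, LinearMap.zero_apply]
    mul_zero := fun x => map_zero (lmul L R x)
    mul_assoc := fun x y z => by
      rw [mul_eq_lmul, lmul_mul, Module.End.mul_apply]; rfl
    one_mul := fun x => by rw [mul_eq_lmul, lmul_one, Module.End.one_apply]
    mul_one := fun x => lmul_apply_one L R x }

noncomputable instance : Algebra (AddMonoidAlgebra R Γ) (HeckeAlgebra L R) :=
  Algebra.ofModule
    (fun a x y => by rw [mul_eq_lmul, map_smul, LinearMap.smul_apply]; rfl)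
    (fun a x y => map_smul (lmul L R x) a y)

open Classical in
/-- The defining multiplication rule of the Iwahori--Hecke algebra. -/
theorem T_simple_mul_T (i : B) (w : W) : T L R (cs.simple i) * T L R w =
    if cs.length w < cs.length (cs.simple i * w) then T L R (cs.simple i * w)
    else T L R (cs.simple i * w) + heckeParam L R i • T L R w := by
  have h : lmul L R (T L R (cs.simple i)) = leftOp L R i := by
    refine end_eq_of_apply_one L R (commute_lmul_rightOp L R _)
      (commute_leftOp_rightOp L R i) ?_
    rw [lmul_apply_one, leftOp_T]
    simp
  rw [mul_eq_lmul, h, leftOp_T]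

end HeckeAlgebra

end Hecke

section Valuation

variable {Γ : Type*} [AddCommGroup Γ] [LinearOrder Γ] [IsOrderedAddMonoid Γ]
  (R : Type*) [CommRing R] [IsDomain R]
  (F : Type*) [Field F] [Algebra R F] [IsFractionRing R F]
  {K : Type*} [Field K] [Algebra (AddMonoidAlgebra R Γ) K]
  [IsFractionRing (AddMonoidAlgebra R Γ) K]

/-- The homomorphism `g ↦ ε^g` from `Γ` to the multiplicative monoid of `K = Frac R[Γ]`. -/
noncomputable def epsHom (K : Type*) [Field K] [Algebra (AddMonoidAlgebra R Γ) K] :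
    Multiplicative Γ →* K :=
  ((algebraMap (AddMonoidAlgebra R Γ) K : AddMonoidAlgebra R Γ →* K)).comp
    (AddMonoidAlgebra.of R Γ)

/-- The element `ε^g` of `K = Frac R[Γ]`. -/
noncomputable def eps (K : Type*) [Field K] [Algebra (AddMonoidAlgebra R Γ) K] (g : Γ) : K :=
  algebraMap (AddMonoidAlgebra R Γ) K (AddMonoidAlgebra.single g 1)

variable (Γ K) in
theorem injective_constants : Function.Injective
    ((algebraMap (AddMonoidAlgebra R Γ) K).comp
      (AddMonoidAlgebra.singleZeroRingHom (R := R) (M := Γ))) :=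
  (IsFractionRing.injective (AddMonoidAlgebra R Γ) K).comp
    AddMonoidAlgebra.single_right_injective

variable (Γ K) in
/-- The inclusion of `F = Frac R` in `K = Frac R[Γ]`. -/
noncomputable def scalarHom : F →+* K :=
  IsFractionRing.lift (injective_constants Γ R K)

variable (K) in
/-- The inclusion of `F[Γ]` in `K = Frac R[Γ]`. -/
noncomputable def laurentHom : AddMonoidAlgebra F Γ →+* K :=
  AddMonoidAlgebra.liftNCRingHom (scalarHom Γ R F K) (epsHom R K) fun _ _ => Commute.all _ _

variable {F} in
/-- `p ∈ F[Γ_{>0}]`. -/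
def PosSupport (p : AddMonoidAlgebra F Γ) : Prop := ∀ g ∈ p.coeff.support, 0 < g

/-- `x = r ε^g (1 + p) / (1 + q)` with `p, q ∈ F[Γ_{>0}]`. -/
def HasNormalForm (x : K) (r : F) (g : Γ) : Prop :=
  ∃ p q : AddMonoidAlgebra F Γ, PosSupport p ∧ PosSupport q ∧
    x = scalarHom Γ R F K r * eps R K g * (laurentHom R F K (1 + p) / laurentHom R F K (1 + q))

variable (Γ K) in
/-- The valuation ring `𝒪` (as a set). -/
def valRing : Set K := {x | x = 0 ∨ ∃ (r : F) (g : Γ), 0 ≤ g ∧ HasNormalForm R F x r g}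

variable (Γ K) in
/-- The maximal ideal `𝔭` of `𝒪` (as a set). -/
def valIdeal : Set K := {x | x = 0 ∨ ∃ (r : F) (g : Γ), 0 < g ∧ HasNormalForm R F x r g}

variable (Γ) in
/-- The constant term of `x ∈ 𝒪`: the unique `r ∈ F` with `x - r ∈ 𝔭`. -/
noncomputable def constTerm (x : K) : F :=
  Classical.epsilon fun r : F => x - scalarHom Γ R F K r ∈ valIdeal Γ R F K

/-- `c = r ε^g +` an `F`-linear combination of terms `ε^h` with `h > g`, where `r ≠ 0`. -/
def HasLowestTerm (c : K) (g : Γ) (r : F) : Prop :=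
  r ≠ 0 ∧ ∃ q : AddMonoidAlgebra F Γ, (∀ h ∈ q.coeff.support, g < h) ∧
    c = scalarHom Γ R F K r * eps R K g + laurentHom R F K q

end Valuation

section Representations

variable {B W : Type*} [Group W] [Fintype W] {M : CoxeterMatrix B} {cs : CoxeterSystem M W}
  {Γ : Type*} [AddCommGroup Γ] [LinearOrder Γ] [IsOrderedAddMonoid Γ]

/-- `{E^λ}` is a complete set of representatives of the isomorphism classes of irreducible
complex representations of the finite group `W`. -/
structure IsCompleteIrr {Λ : Type*} {d : Λ → ℕ}
    (E : ∀ l, Representation ℂ W (Fin (d l) → ℂ)) : Prop where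
  irreducible : ∀ l, (E l).IsIrreducible
  injective : ∀ l m, Nonempty ((E l).Equiv (E m)) → l = m
  surjective : ∀ (n : ℕ) (V : Representation ℂ W (Fin n → ℂ)), V.IsIrreducible →
    ∃ l, Nonempty (V.Equiv (E l))

/-- The specialisation `θ₁ : R[Γ] → R`, `ε^g ↦ 1`. -/
noncomputable def theta (R : Type*) [CommRing R] : AddMonoidAlgebra R Γ →ₐ[R] R :=
  AddMonoidAlgebra.lift R R Γ 1

open scoped TensorProduct

variable (L : WeightFunction cs Γ) (R : Type*) [CommRing R] [IsDomain R]
  (F : Type*) [Field F] [Algebra R F] [IsFractionRing R F]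
  (K : Type*) [Field K] [Algebra (AddMonoidAlgebra R Γ) K]
  [IsFractionRing (AddMonoidAlgebra R Γ) K]

/-- Matrix representations of degree `d` of `H_K = K ⊗_A H`. -/
abbrev MatrixRep (d : ℕ) : Type _ :=
  (K ⊗[AddMonoidAlgebra R Γ] HeckeAlgebra L R) →ₐ[K] Matrix (Fin d) (Fin d) K

variable {L R K} {d : ℕ} (ρ : MatrixRep L R K d)

/-- The matrix `ρ(T_w)`. -/
noncomputable def repT (w : W) : Matrix (Fin d) (Fin d) K := ρ (1 ⊗ₜ HeckeAlgebra.T L R w)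

/-- `ρ` is irreducible: `K^d` is non-zero and has no invariant subspaces but `0` and `K^d`. -/
def IsIrreducibleRep : Prop :=
  d ≠ 0 ∧ ∀ U : Submodule K (Fin d → K), (∀ h, ∀ v ∈ U, (ρ h).mulVec v ∈ U) → U = ⊥ ∨ U = ⊤

/-- `ρ` is an irreducible representation of `H_K` that corresponds to the irreducible
representation `E` of `W`: the traces of the `T_w` lie in `A = R[Γ]` and
`θ₁(trace ρ(T_w)) = trace(w, E)` for all `w ∈ W`. -/
def IsAffordedBy {R : Subring ℂ} {K : Type*} [Field K] [Algebra (AddMonoidAlgebra R Γ) K]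
    (ρ : MatrixRep L R K d) (E : Representation ℂ W (Fin d → ℂ)) : Prop :=
  IsIrreducibleRep ρ ∧
    ∀ w : W, ∃ a : AddMonoidAlgebra R Γ,
      algebraMap (AddMonoidAlgebra R Γ) K a = (repT ρ w).trace ∧
        ((theta R a : R) : ℂ) = E.character w

/-- The element `c_λ`, given by `∑_w trace ρ(T_w) trace ρ(T_{w⁻¹}) = d_λ c_λ`. -/
noncomputable def schurElement : K :=
  (d : K)⁻¹ * ∑ w : W, (repT ρ w).trace * (repT ρ w⁻¹).trace

/-- The invariant `a_λ`: the lowest term of `c_λ` is `f_λ ε^{-2 a_λ}`. -/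
noncomputable def aInv : Γ :=
  Classical.epsilon fun a : Γ => ∃ f : F, HasLowestTerm R F (schurElement ρ) (-(2 • a)) f

/-- The invariant `f_λ`: the lowest term of `c_λ` is `f_λ ε^{-2 a_λ}`. -/
noncomputable def fInv : F :=
  Classical.epsilon fun f : F => ∃ a : Γ, HasLowestTerm R F (schurElement ρ) (-(2 • a)) f

/-- `ρ` is balanced: `ε^{a_λ} ρ_{ij}(T_w) ∈ 𝒪` for all `w`, `i`, `j`. -/
def IsBalanced : Prop :=
  ∀ (w : W) (i j : Fin d), eps R K (aInv F ρ) * repT ρ w i j ∈ valRing Γ R F K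

/-- The leading matrix coefficient `c_{w,λ}^{ij}`: the constant term of
`(-1)^{ℓ(w)} ε^{a_λ} ρ_{ij}(T_w)`. -/
noncomputable def leadCoeff (w : W) (i j : Fin d) : F :=
  constTerm Γ R F ((-1) ^ cs.length w * eps R K (aInv F ρ) * repT ρ w i j)

end Representations

section JTilde

variable {B W : Type*} [Group W] [Fintype W] {M : CoxeterMatrix B} {cs : CoxeterSystem M W}
  {Γ : Type*} [AddCommGroup Γ] [LinearOrder Γ] [IsOrderedAddMonoid Γ]
  {L : WeightFunction cs Γ} {R : Type*} [CommRing R] [IsDomain R]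
  (F : Type*) [Field F] [Algebra R F] [IsFractionRing R F]
  {K : Type*} [Field K] [Algebra (AddMonoidAlgebra R Γ) K]
  [IsFractionRing (AddMonoidAlgebra R Γ) K]
  {Λ : Type*} [Fintype Λ] {d : Λ → ℕ} (ρ : ∀ l, MatrixRep L R K (d l))

/-- The constants `γ̃_{x,y,z}`. -/
noncomputable def gammaTilde (x y z : W) : F :=
  ∑ l : Λ, ∑ i, ∑ j, ∑ k, (fInv F (ρ l))⁻¹ *
    leadCoeff F (ρ l) x i j * leadCoeff F (ρ l) y j k * leadCoeff F (ρ l) z k i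

/-- The constants `ñ_w`. -/
noncomputable def nTilde (w : W) : F :=
  ∑ l : Λ, ∑ i, (fInv F (ρ l))⁻¹ * leadCoeff F (ρ l) w⁻¹ i i

/-- The bilinear product on the `F`-vector space `J̃ = W →₀ F`, with basis
`t_w = Finsupp.single w 1`, given by `t_x t_y = ∑_z γ̃_{x,y,z⁻¹} t_z`. -/
noncomputable def jMul : (W →₀ F) →ₗ[F] (W →₀ F) →ₗ[F] (W →₀ F) :=
  Finsupp.basisSingleOne.constr F fun x => Finsupp.basisSingleOne.constr F fun y =>
    ∑ z : W, gammaTilde F ρ x y z⁻¹ • Finsupp.single z 1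

open Classical in
/-- The element `∑_{w ∈ D̃} ñ_w t_w`, where `D̃ = {w | ñ_w ≠ 0}`. -/
noncomputable def jOne : W →₀ F :=
  ∑ w : W with nTilde F ρ w ≠ 0, nTilde F ρ w • Finsupp.single w 1

end JTilde

end IwahoriHecke

open IwahoriHecke

/-!
Since `ε^{L(s)} - ε^{-L(s)}` specializes to `0` under `θ₁`, the trace form `∑ d_λ trace ρ^λ` on `H`
specializes to `|W|` times the standard symmetrizing trace of the group algebra, so it is
nondegenerate and `H_K → ∏ M_{d_λ}(K)` is an isomorphism. The Casimir element `∑ T_w ⊗ T_{w⁻¹}`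
then gives the Schur relations for the matrix coefficients `ρ^λ_{ij}(T_w)`, with
Schur elements `c_λ`.

`K` embeds in the field of Hahn series over `ℂ`, with conjugation acting on coefficients. Averaging
the standard Hermitian form over the `ρ^λ(T_w)` shows that `trace ρ^λ(T_{w⁻¹})` is the conjugate of
`trace ρ^λ(T_w)`. Hence `d_λ c_λ` is a sum of terms `x * star x`, whose lowest terms cannot cancel:
this is why the lowest exponent of `c_λ` is even and `a_λ` is well defined.

As the `ρ^λ` are balanced, the coefficients at `ε^{-(a_λ + a_μ)}` in the Schur relations involve the
leading coefficients only, which therefore satisfy Schur relations over `F` with Schur elements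
`f_λ`. In particular `t_w ↦ (c_{w,λ})_λ` identifies `J̃` with `∏ M_{d_λ}(F)`.
-/

namespace IwahoriHecke

section GroupCharacters

open Representation

theorem isIrreducible_of_surjective_asAlgebraHom {k G V : Type*} [Field k] [Monoid G]
    [AddCommGroup V] [Module k V] [Nontrivial V] {σ : Representation k G V}
    (h : Function.Surjective σ.asAlgebraHom) : σ.IsIrreducible := by
  rw [irreducible_iff_isSimpleModule_asModule, isSimpleModule_iff_toSpanSingleton_surjective]
  refine ⟨σ.asModuleEquiv.toEquiv.nontrivial, fun v hv u => ?_⟩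
  obtain ⟨f, hf⟩ := IsSimpleModule.toSpanSingleton_surjective (Module.End k V)
    (σ.asModuleEquiv.map_ne_zero_iff.mpr hv) (σ.asModuleEquiv u)
  obtain ⟨x, rfl⟩ := h f
  exact ⟨x, σ.asModuleEquiv.injective hf⟩

theorem nontrivial_of_isIrreducible {k G V : Type*} [Field k] [Monoid G] [AddCommGroup V]
    [Module k V] {σ : Representation k G V} (h : σ.IsIrreducible) : Nontrivial V :=
  have := (irreducible_iff_isSimpleModule_asModule σ).mp h
  have := IsSimpleModule.nontrivial (MonoidAlgebra k G) σ.asModule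
  σ.asModuleEquiv.symm.toEquiv.nontrivial

theorem asAlgebraHom_apply_of_equiv {k G V V' : Type*} [Field k] [Monoid G]
    [AddCommGroup V] [Module k V] [AddCommGroup V'] [Module k V'] {σ : Representation k G V}
    {σ' : Representation k G V'} (φ : σ.Equiv σ') (x : MonoidAlgebra k G) (v : V) :
    φ (σ.asAlgebraHom x v) = σ'.asAlgebraHom x (φ v) :=
  (IntertwiningMap.equivLinearMapAsModule σ σ' φ.toIntertwiningMap).map_smul x v

theorem asAlgebraHom_eq_zero_of_trace_eq_zero {k G V : Type*} [Field k] [CharZero k]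
    [IsAlgClosed k] [Monoid G] [AddCommGroup V] [Module k V] [FiniteDimensional k V]
    {σ : Representation k G V} (hσ : σ.IsIrreducible) {z : MonoidAlgebra k G}
    (hz : z ∈ Submonoid.center (MonoidAlgebra k G))
    (h : LinearMap.trace k V (σ.asAlgebraHom z) = 0) : σ.asAlgebraHom z = 0 := by
  obtain ⟨c, hc⟩ :=
    (IsIrreducible.algebraMap_intertwiningMap_bijective_of_isAlgClosed (ρ := σ)).2
      (IntertwiningMap.centralAlgebraMul σ hz)
  have hc : σ.asAlgebraHom z = c • (1 : Module.End k V) :=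
    (congrArg IntertwiningMap.toLinearMap hc).symm
  have : Nontrivial V := nontrivial_of_isIrreducible hσ
  rw [hc, map_smul, LinearMap.trace_one, smul_eq_mul, mul_eq_zero, Nat.cast_eq_zero] at h
  rw [hc, h.resolve_right Module.finrank_pos.ne', zero_smul]

theorem sum_single_mem_center {k G : Type*} [CommSemiring k] [Group G] [Fintype G] {D : G → k}
    (hD : ∀ g h, D (h * g * h⁻¹) = D g) :
    ∑ g, MonoidAlgebra.single g (D g) ∈ Submonoid.center (MonoidAlgebra k G) := by
  refine Submonoid.mem_center_iff.mpr fun x => ?_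
  induction x using MonoidAlgebra.induction_linear with
  | zero => simp
  | add x y hx hy => rw [add_mul, mul_add, hx, hy]
  | single h a =>
    rw [Finset.sum_mul, Finset.mul_sum]
    refine Fintype.sum_equiv (MulAut.conj h).toEquiv _ _ fun g => ?_
    simp [MonoidAlgebra.single_mul_single, hD, mul_comm a]

variable {W : Type*} [Group W] {Λ : Type*} {d : Λ → ℕ}
  {E : ∀ l, Representation ℂ W (Fin (d l) → ℂ)}

theorem IsCompleteIrr.dim_ne_zero (hE : IsCompleteIrr E) (l : Λ) : d l ≠ 0 := by
  have := nontrivial_of_isIrreducible (hE.irreducible l)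
  simpa using (Module.finrank_pos (R := ℂ) (M := Fin (d l) → ℂ)).ne'

theorem eq_zero_of_forall_asAlgebraHom_eq_zero [Finite W] (hE : IsCompleteIrr E)
    {x : MonoidAlgebra ℂ W} (hx : ∀ l, (E l).asAlgebraHom x = 0) : x = 0 := by
  obtain ⟨n, m, hm, ⟨e⟩⟩ :=
    IsSemisimpleRing.exists_algEquiv_pi_matrix_of_isAlgClosed ℂ (MonoidAlgebra ℂ W)
  refine e.injective (funext fun a => ?_)
  let π : MonoidAlgebra ℂ W →ₐ[ℂ] Module.End ℂ (Fin (m a) → ℂ) :=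
    Matrix.toLinAlgEquiv'.toAlgHom.comp ((Pi.evalAlgHom ℂ _ a).comp e.toAlgHom)
  let σ : Representation ℂ W (Fin (m a) → ℂ) := (MonoidAlgebra.lift ℂ _ W).symm π
  have hσ : σ.asAlgebraHom = π := (MonoidAlgebra.lift ℂ _ W).apply_symm_apply π
  have hπ : Function.Surjective π :=
    Matrix.toLinAlgEquiv'.surjective.comp ((Function.surjective_eval a).comp e.surjective)
  obtain ⟨l, ⟨φ⟩⟩ := hE.surjective _ σ (isIrreducible_of_surjective_asAlgebraHom (hσ ▸ hπ))
  have hπx : π x = 0 := by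
    refine LinearMap.ext fun v => φ.toLinearEquiv.injective ?_
    rw [← hσ, LinearMap.zero_apply, map_zero]
    exact (asAlgebraHom_apply_of_equiv φ x v).trans (by rw [hx, LinearMap.zero_apply])
  rw [map_zero]
  exact Matrix.toLinAlgEquiv'.injective (hπx.trans (map_zero _).symm)

variable [Fintype W]

theorem classFunction_eq_zero (hE : IsCompleteIrr E) {D : W → ℂ}
    (hD : ∀ g h, D (h * g * h⁻¹) = D g) (hDE : ∀ l, ∑ g, D g * (E l).character g = 0) :
    D = 0 := by
  have hz : ∑ g, MonoidAlgebra.single g (D g) = 0 :=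
    eq_zero_of_forall_asAlgebraHom_eq_zero hE fun l =>
      asAlgebraHom_eq_zero_of_trace_eq_zero (hE.irreducible l) (sum_single_mem_center hD) <| by
        simpa [character] using hDE l
  funext g
  classical
  simpa [Finsupp.single_apply] using congrArg (fun x : MonoidAlgebra ℂ W => x.coeff g) hz

theorem sum_character_mul_character_inv (hE : IsCompleteIrr E) [DecidableEq Λ] (l m : Λ) :
    ∑ g, (E l).character g * (E m).character g⁻¹ = if l = m then (Fintype.card W : ℂ) else 0 := by
  classical
  have := hE.irreducible l
  have := hE.irreducible m
  have hcard : (Nat.card W : ℂ) ≠ 0 := Nat.cast_ne_zero.mpr Nat.card_pos.ne'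
  have : Invertible (Nat.card W : ℂ) := invertibleOfNonzero hcard
  have hiff : Nonempty ((E m).Equiv (E l)) ↔ l = m :=
    ⟨fun h => (hE.injective _ _ h).symm, by rintro rfl; exact ⟨.refl _⟩⟩
  have h := char_orthonormal (E l) (E m)
  rw [inv_mul_eq_iff_eq_mul₀ hcard] at h
  simp [h, hiff]

theorem sum_dim_mul_character (hE : IsCompleteIrr E) [Fintype Λ] [DecidableEq W] (g : W) :
    ∑ l, (d l : ℂ) * (E l).character g = if g = 1 then (Fintype.card W : ℂ) else 0 := by
  classical
  let D : W → ℂ := fun g => (∑ l, (d l : ℂ) * (E l).character g⁻¹) -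
    if g = 1 then (Fintype.card W : ℂ) else 0
  suffices hD : D = 0 by simpa [D, sub_eq_zero] using congrFun hD g⁻¹
  refine classFunction_eq_zero hE (fun g h => ?_) fun m => ?_
  · have hinv : (h * g * h⁻¹)⁻¹ = h * g⁻¹ * h⁻¹ := by group
    simp only [D, hinv, char_conj, conj_eq_one_iff]
  · have horth : ∀ l, ∑ g, (d l : ℂ) * (E l).character g⁻¹ * (E m).character g =
        if m = l then (d l : ℂ) * Fintype.card W else 0 := fun l => by
      simp only [mul_assoc, ← Finset.mul_sum, mul_comm ((E l).character _),
        sum_character_mul_character_inv hE m l, mul_ite, mul_zero]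
    simp only [D, sub_mul, Finset.sum_sub_distrib, Finset.sum_mul]
    rw [Finset.sum_comm]
    simp only [horth]
    simp [mul_comm]

theorem sum_dim_sq (hE : IsCompleteIrr E) [Fintype Λ] : ∑ l, d l * d l = Fintype.card W := by
  classical
  simpa [← Nat.cast_inj (R := ℂ)] using sum_dim_mul_character hE 1

end GroupCharacters

section Hecke

open scoped TensorProduct

variable {B W : Type*} [Group W] {M : CoxeterMatrix B} {cs : CoxeterSystem M W}

variable (cs) in
theorem simple_mul_induction {p : W → Prop} (one : p 1)
    (simple_mul : ∀ i w, cs.length w < cs.length (cs.simple i * w) → p w → p (cs.simple i * w))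
    (w : W) : p w := by
  obtain ⟨ω, hω, rfl⟩ := cs.exists_isReduced w
  induction ω with
  | nil => simpa using one
  | cons i ω ih =>
    have htail : cs.IsReduced ω := by simpa using hω.drop 1
    have hlen := hω.eq
    rw [cs.wordProd_cons, List.length_cons] at hlen
    rw [cs.wordProd_cons]
    exact simple_mul i _ (by rw [hlen, htail.eq]; exact Nat.lt_succ_self _) (ih htail)

variable {Γ : Type*} [AddCommGroup Γ] (L : WeightFunction cs Γ) (R : Type*) [CommRing R]

namespace HeckeAlgebra

theorem mul_T_simple (x : HeckeAlgebra L R) (i : B) :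
    x * T L R (cs.simple i) = rightOp L R i x := by
  have h : T L R (cs.simple i) = rightOp L R i (T L R 1) := by simp [rightOp_T]
  rw [mul_eq_lmul, h, ← Module.End.mul_apply, (commute_lmul_rightOp L R x i).eq,
    Module.End.mul_apply, lmul_apply_one]

open Classical in
theorem T_mul_T_simple (w : W) (i : B) : T L R w * T L R (cs.simple i) =
    T L R (w * cs.simple i) +
      (if cs.length w < cs.length (w * cs.simple i) then 0 else heckeParam L R i) • T L R w := by
  rw [mul_T_simple, rightOp_T]
  split_ifs <;> simp

open Classical in
theorem T_simple_mul_T_eq_add (i : B) (w : W) : T L R (cs.simple i) * T L R w =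
    T L R (cs.simple i * w) +
      (if cs.length w < cs.length (cs.simple i * w) then 0 else heckeParam L R i) • T L R w := by
  rw [T_simple_mul_T]
  split_ifs <;> simp

theorem T_simple_mul_T_of_lt {i : B} {w : W} (h : cs.length w < cs.length (cs.simple i * w)) :
    T L R (cs.simple i) * T L R w = T L R (cs.simple i * w) := by
  rw [T_simple_mul_T, if_pos h]

/-- The Casimir element of the dual bases `T_w` and `T_{w⁻¹}` for the symmetrizing trace of `H`. -/
noncomputable def casimir [Fintype W] :
    HeckeAlgebra L R ⊗[AddMonoidAlgebra R Γ] HeckeAlgebra L R :=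
  ∑ w : W, T L R w ⊗ₜ T L R w⁻¹

theorem T_simple_tmul_one_mul_casimir [Fintype W] (i : B) :
    (T L R (cs.simple i) ⊗ₜ 1) * casimir L R = casimir L R * (1 ⊗ₜ T L R (cs.simple i)) := by
  have hlength : ∀ w, cs.length (w⁻¹ * cs.simple i) = cs.length (cs.simple i * w) := fun w => by
    rw [← cs.length_inv (cs.simple i * w), mul_inv_rev, cs.inv_simple]
  simp only [casimir, Finset.mul_sum, Finset.sum_mul, Algebra.TensorProduct.tmul_mul_tmul, one_mul,
    mul_one, T_simple_mul_T_eq_add, T_mul_T_simple, TensorProduct.add_tmul, TensorProduct.tmul_add,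
    TensorProduct.smul_tmul', TensorProduct.tmul_smul, Finset.sum_add_distrib, hlength,
    cs.length_inv]
  congr 1
  exact Fintype.sum_equiv (Equiv.mulLeft (cs.simple i)) _ _ fun w => by simp

theorem tmul_one_mul_casimir [Fintype W] (h : HeckeAlgebra L R) :
    (h ⊗ₜ 1) * casimir L R = casimir L R * (1 ⊗ₜ h) := by
  induction (basis L R).mem_span h using Submodule.span_induction with
  | zero => simp
  | add x y _ _ hx hy =>
    rw [TensorProduct.add_tmul, TensorProduct.tmul_add, add_mul, mul_add, hx, hy]
  | smul a x _ hx =>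
    rw [TensorProduct.tmul_smul, ← TensorProduct.smul_tmul', smul_mul_assoc, hx, mul_smul_comm]
  | mem x hx =>
    obtain ⟨w, rfl⟩ := hx
    change (T L R w ⊗ₜ 1) * _ = _ * (1 ⊗ₜ T L R w)
    induction w using simple_mul_induction cs with
    | one => rw [← one_eq_T, ← Algebra.TensorProduct.one_def, one_mul, mul_one]
    | simple_mul i w hw ih =>
      have hleft : (T L R (cs.simple i * w) ⊗ₜ[AddMonoidAlgebra R Γ] (1 : HeckeAlgebra L R)) =
          (T L R (cs.simple i) ⊗ₜ 1) * (T L R w ⊗ₜ 1) := by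
        simp [T_simple_mul_T_of_lt L R hw]
      have hright : ((1 : HeckeAlgebra L R) ⊗ₜ[AddMonoidAlgebra R Γ] T L R (cs.simple i * w)) =
          (1 ⊗ₜ T L R (cs.simple i)) * (1 ⊗ₜ T L R w) := by
        simp [T_simple_mul_T_of_lt L R hw]
      rw [hleft, hright, mul_assoc, ih, ← mul_assoc, T_simple_tmul_one_mul_casimir, mul_assoc]

section Specialization

variable {R} {k : Type*} [CommRing k] {θ : AddMonoidAlgebra R Γ →+* k}

theorem constr_T (a : W → AddMonoidAlgebra R Γ) (w : W) :
    (basis L R).constr (AddMonoidAlgebra R Γ) a (T L R w) = a w :=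
  (basis L R).constr_basis _ a w

theorem map_constr_T_simple_mul (hθ : ∀ i, θ (heckeParam L R i) = 0) (a : W → AddMonoidAlgebra R Γ)
    (i : B) (h : HeckeAlgebra L R) :
    θ ((basis L R).constr (AddMonoidAlgebra R Γ) a (T L R (cs.simple i) * h)) =
      θ ((basis L R).constr (AddMonoidAlgebra R Γ) (fun w => a (cs.simple i * w)) h) := by
  induction (basis L R).mem_span h using Submodule.span_induction with
  | zero => simp
  | add x y _ _ hx hy => simp only [mul_add, map_add, hx, hy]
  | smul b x _ hx => simp only [mul_smul_comm, map_smul, smul_eq_mul, map_mul, hx]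
  | mem x hx =>
    obtain ⟨w, rfl⟩ := hx
    change θ ((basis L R).constr _ a (_ * T L R w)) = θ ((basis L R).constr _ _ (T L R w))
    rw [T_simple_mul_T_eq_add, map_add, map_smul, map_add, smul_eq_mul, map_mul, constr_T, constr_T,
      constr_T]
    split_ifs <;> simp [hθ]

theorem map_constr_T_mul_T (hθ : ∀ i, θ (heckeParam L R i) = 0) (a : W → AddMonoidAlgebra R Γ)
    (x y : W) : θ ((basis L R).constr (AddMonoidAlgebra R Γ) a (T L R x * T L R y)) =
      θ (a (x * y)) := by
  induction x using simple_mul_induction cs generalizing a with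
  | one => rw [← one_eq_T, one_mul, one_mul, constr_T]
  | simple_mul i w hw ih =>
    rw [← T_simple_mul_T_of_lt L R hw, mul_assoc, map_constr_T_simple_mul L hθ, ih, mul_assoc]

end Specialization
end HeckeAlgebra
end Hecke

section SchurRelations

open HeckeAlgebra
open scoped TensorProduct

/-- The relations satisfied by the matrix coefficients `c l w i j` of a complete family of
irreducible representations of a symmetric algebra with basis indexed by `W` and dual basis indexed
by the inverses; `f l` are the Schur elements. They hold for the `ρ^λ(T_w)` and are inherited by the
leading coefficients `c_{w,λ}`. -/
structure SchurRelations {W Λ k : Type*} [Group W] [Fintype W] [CommRing k] {d : Λ → ℕ}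
    (f : Λ → k) (c : ∀ l, W → Matrix (Fin (d l)) (Fin (d l)) k) : Prop where
  sum_of_ne : ∀ {l m : Λ}, l ≠ m → ∀ i j i' j', ∑ w, c l w i j * c m w⁻¹ i' j' = 0
  sum_self : ∀ l i j i' j',
    ∑ w, c l w i j * c l w⁻¹ i' j' = if i = j' ∧ j = i' then f l else 0

variable {B W : Type*} [Group W] {M : CoxeterMatrix B} {cs : CoxeterSystem M W}
  {Γ : Type*} [AddCommGroup Γ] {L : WeightFunction cs Γ}

section Averages

variable {R : Type*} [CommRing R] {K : Type*} [Field K] [Algebra (AddMonoidAlgebra R Γ) K]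
  {d e : ℕ} (ρ : MatrixRep L R K d) (σ : MatrixRep L R K e)

theorem repT_one : repT ρ (1 : W) = 1 := map_one ρ

theorem repT_simple_mul_of_lt {i : B} {w : W} (h : cs.length w < cs.length (cs.simple i * w)) :
    repT ρ (cs.simple i * w) = repT ρ (cs.simple i) * repT ρ w := by
  simp only [repT, ← map_mul, Algebra.TensorProduct.tmul_mul_tmul, one_mul,
    T_simple_mul_T_of_lt L R h]

/-- The restriction of a matrix representation of `H_K` to `H`. -/
noncomputable def repH : HeckeAlgebra L R →ₐ[AddMonoidAlgebra R Γ] Matrix (Fin d) (Fin d) K :=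
  (ρ.restrictScalars (AddMonoidAlgebra R Γ)).comp Algebra.TensorProduct.includeRight

theorem repH_T (w : W) : repH ρ (T L R w) = repT ρ w := rfl

variable [Fintype W]

/-- The image of the matrix `φ` under the action of the Casimir element by `ρ` on the left and by
`σ` on the right. -/
noncomputable def average (φ : Matrix (Fin d) (Fin e) K) : Matrix (Fin d) (Fin e) K :=
  ∑ w : W, repT ρ w * φ * repT σ w⁻¹

theorem repH_mul_average (φ : Matrix (Fin d) (Fin e) K) (h : HeckeAlgebra L R) :
    repH ρ h * average ρ σ φ = average ρ σ φ * repH σ h := by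
  let act := TensorProduct.lift <| LinearMap.mk₂ (AddMonoidAlgebra R Γ)
    (fun x y => repH ρ x * φ * repH σ y) (fun x y z => by simp [Matrix.add_mul])
    (fun a x y => by simp) (fun x y z => by simp [Matrix.mul_add]) (fun a x y => by simp)
  simpa [act, casimir, average, Finset.mul_sum, Finset.sum_mul, Matrix.mul_sum, Matrix.sum_mul,
    repH_T, Matrix.mul_assoc] using congrArg act (tmul_one_mul_casimir L R h)

theorem mul_average (φ : Matrix (Fin d) (Fin e) K)
    (h : K ⊗[AddMonoidAlgebra R Γ] HeckeAlgebra L R) :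
    ρ h * average ρ σ φ = average ρ σ φ * σ h := by
  induction h with
  | zero => simp
  | add x y hx hy => rw [map_add, map_add, Matrix.add_mul, Matrix.mul_add, hx, hy]
  | tmul a h =>
    have hsmul : a ⊗ₜ h = a • ((1 : K) ⊗ₜ[AddMonoidAlgebra R Γ] h) := by
      simp [TensorProduct.smul_tmul']
    rw [hsmul, map_smul, map_smul, Matrix.smul_mul, Matrix.mul_smul]
    exact congrArg (a • ·) (repH_mul_average ρ σ φ h)

theorem average_single_apply (i j : Fin d) (i' j' : Fin e) :
    average ρ σ (.single j i' 1) i j' = ∑ w : W, repT ρ w i j * repT σ w⁻¹ i' j' := by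
  rw [average, Matrix.sum_apply]
  refine Finset.sum_congr rfl fun w _ => ?_
  rw [Matrix.mul_assoc, Matrix.mul_apply, Finset.sum_eq_single j
    (fun b _ hb => by rw [Matrix.single_mul_apply_of_ne _ _ _ _ _ hb, mul_zero]) (by simp),
    Matrix.single_mul_apply_same, one_mul]

theorem sum_repT_mul_repT_inv_comm (i j i' j' : Fin d) :
    ∑ w : W, repT ρ w i j * repT ρ w⁻¹ i' j' = ∑ w : W, repT ρ w i' j' * repT ρ w⁻¹ i j :=
  Fintype.sum_equiv (Equiv.inv W) _ _ fun w => by simp [mul_comm]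

end Averages

section JointMap

variable {R : Type*} [CommRing R] {K : Type*} [Field K] [Algebra (AddMonoidAlgebra R Γ) K]
  {k : Type*} [CommRing k]

/-- The character values of `ρ` at the `T_w` lie in `A = R[Γ]` and specialize under `θ` to the
function `χ` on `W`. -/
def SpecializesTo {d : ℕ} (θ : AddMonoidAlgebra R Γ →+* k) (ρ : MatrixRep L R K d) (χ : W → k) :
    Prop :=
  ∀ w, ∃ a : AddMonoidAlgebra R Γ, algebraMap _ K a = (repT ρ w).trace ∧ θ a = χ w

theorem trace_repH {d : ℕ} (ρ : MatrixRep L R K d) {a : W → AddMonoidAlgebra R Γ}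
    (ha : ∀ w, algebraMap _ K (a w) = (repT ρ w).trace) (h : HeckeAlgebra L R) :
    (repH ρ h).trace = algebraMap _ K ((basis L R).constr (AddMonoidAlgebra R Γ) a h) := by
  have hmaps : Matrix.traceLinearMap (Fin d) (AddMonoidAlgebra R Γ) K ∘ₗ (repH ρ).toLinearMap =
      Algebra.linearMap _ K ∘ₗ (basis L R).constr (AddMonoidAlgebra R Γ) a :=
    (basis L R).ext fun w => (ha w).symm.trans (congrArg _ (constr_T L a w).symm)
  exact LinearMap.congr_fun hmaps h

variable {Λ : Type*} {d : Λ → ℕ} (ρ : ∀ l, MatrixRep L R K (d l))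

theorem exists_trace_form [Fintype Λ] {θ : AddMonoidAlgebra R Γ →+* k} {χ : Λ → W → k}
    (hρ : ∀ l, SpecializesTo θ (ρ l) (χ l)) : ∃ a : W → AddMonoidAlgebra R Γ,
      (∀ w, θ (a w) = ∑ l, d l * χ l w) ∧
      ∀ h, algebraMap _ K ((basis L R).constr (AddMonoidAlgebra R Γ) a h) =
        ∑ l, (d l : K) * (repH (ρ l) h).trace := by
  choose a htrace hχ using hρ
  refine ⟨fun w => ∑ l, d l * a l w, fun w => by simp [hχ], fun h => ?_⟩
  have hmaps : Algebra.linearMap _ K ∘ₗ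
      (basis L R).constr (AddMonoidAlgebra R Γ) (fun w => ∑ l, d l * a l w) =
      ∑ l, d l • Algebra.linearMap _ K ∘ₗ
        (basis L R).constr (AddMonoidAlgebra R Γ) (a l) :=
    (basis L R).ext fun w => by simp [-Module.Basis.constr_apply_fintype]
  simpa [trace_repH _ (htrace _), -Module.Basis.constr_apply_fintype] using
    LinearMap.congr_fun hmaps h

theorem det_constr_T_mul_T_ne_zero [Fintype W] [IsDomain k] [CharZero k] [DecidableEq W]
    {θ : AddMonoidAlgebra R Γ →+* k} (hθ : ∀ i, θ (heckeParam L R i) = 0)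
    {a : W → AddMonoidAlgebra R Γ}
    (ha : ∀ w, θ (a w) = if w = 1 then (Fintype.card W : k) else 0) :
    (Matrix.of fun x y => (basis L R).constr (AddMonoidAlgebra R Γ) a (T L R x * T L R y)).det ≠
      0 := by
  set G := Matrix.of fun x y =>
    (basis L R).constr (AddMonoidAlgebra R Γ) a (T L R x * T L R y)
  have hG : G.map θ = (Fintype.card W : k) • (Equiv.inv W).toPEquiv.toMatrix := by
    ext x y
    change θ ((basis L R).constr (AddMonoidAlgebra R Γ) a (T L R x * T L R y)) = _
    rw [map_constr_T_mul_T L hθ, ha]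
    simp [PEquiv.toMatrix_apply, mul_eq_one_iff_inv_eq]
  have hdet : θ G.det ≠ 0 := by
    rw [RingHom.map_det, RingHom.mapMatrix_apply, hG, Matrix.det_smul, Matrix.det_permutation]
    simp
  exact fun h => hdet (by rw [h, map_zero])

theorem injective_pi_of_specializesTo [Finite Λ] [Finite W]
    [FaithfulSMul (AddMonoidAlgebra R Γ) K]
    {θ : AddMonoidAlgebra R Γ →+* ℂ} (hθ : ∀ i, θ (heckeParam L R i) = 0)
    {E : ∀ l, Representation ℂ W (Fin (d l) → ℂ)} (hE : IsCompleteIrr E)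
    (hρ : ∀ l, SpecializesTo θ (ρ l) (E l).character) :
    Function.Injective (AlgHom.pi ρ) := by
  classical
  cases nonempty_fintype Λ
  cases nonempty_fintype W
  obtain ⟨a, hθa, htrace⟩ := exists_trace_form ρ hρ
  have hdet := det_constr_T_mul_T_ne_zero (L := L) hθ
    fun w => (hθa w).trans (sum_dim_mul_character hE w)
  set G := Matrix.of fun x y =>
    (basis L R).constr (AddMonoidAlgebra R Γ) a (T L R x * T L R y)
  have hdetK : (G.map (algebraMap _ K)).det ≠ 0 := by
    rw [← RingHom.mapMatrix_apply, ← RingHom.map_det]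
    exact (map_ne_zero_iff _ (FaithfulSMul.algebraMap_injective _ K)).mpr hdet
  rw [injective_iff_map_eq_zero]
  intro h hh
  set c := (Algebra.TensorProduct.basis K (basis L R)).repr h
  have hzero : ∀ l, ∑ x, c x • repT (ρ l) x = 0 := fun l => by
    rw [← (Algebra.TensorProduct.basis K (basis L R)).sum_repr h] at hh
    simpa [Algebra.TensorProduct.basis_apply, c, repT, T] using congrFun hh l
  have hc : (c : W → K) = 0 := by
    refine Matrix.eq_zero_of_vecMul_eq_zero hdetK (funext fun y => ?_)
    have hpair : ∀ l, ∑ x, c x * (repT (ρ l) x * repT (ρ l) y).trace = 0 := fun l => by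
      simpa [Finset.sum_mul, Matrix.trace_sum] using
        congrArg (fun X => (X * repT (ρ l) y).trace) (hzero l)
    simp only [Matrix.vecMul, dotProduct, Matrix.map_apply, G, Matrix.of_apply, htrace, map_mul,
      repH_T, Finset.mul_sum, Pi.zero_apply, mul_left_comm (c _)]
    rw [Finset.sum_comm]
    simp only [← Finset.mul_sum, hpair, mul_zero, Finset.sum_const_zero]
  exact (Algebra.TensorProduct.basis K (basis L R)).repr.map_eq_zero_iff.mp
    (DFunLike.coe_injective hc)

theorem surjective_pi_of_specializesTo [Finite Λ] [Finite W]
    [FaithfulSMul (AddMonoidAlgebra R Γ) K]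
    {θ : AddMonoidAlgebra R Γ →+* ℂ} (hθ : ∀ i, θ (heckeParam L R i) = 0)
    {E : ∀ l, Representation ℂ W (Fin (d l) → ℂ)} (hE : IsCompleteIrr E)
    (hρ : ∀ l, SpecializesTo θ (ρ l) (E l).character) :
    Function.Surjective (AlgHom.pi ρ) := by
  cases nonempty_fintype Λ
  cases nonempty_fintype W
  have hfinite : FiniteDimensional K (K ⊗[AddMonoidAlgebra R Γ] HeckeAlgebra L R) :=
    .of_basis (Algebra.TensorProduct.basis K (basis L R))
  have hrank : Module.finrank K (K ⊗[AddMonoidAlgebra R Γ] HeckeAlgebra L R) =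
      Module.finrank K (∀ l, Matrix (Fin (d l)) (Fin (d l)) K) := by
    rw [Module.finrank_eq_card_basis (Algebra.TensorProduct.basis K (basis L R)),
      Module.finrank_pi_fintype, ← sum_dim_sq hE]
    simp [Module.finrank_matrix]
  exact (LinearMap.injective_iff_surjective_of_finrank_eq_finrank
    (f := (AlgHom.pi ρ).toLinearMap) hrank).mp (injective_pi_of_specializesTo ρ hθ hE hρ)

end JointMap

section Orthogonality

variable {R : Type*} [CommRing R] {K : Type*} [Field K] [Algebra (AddMonoidAlgebra R Γ) K]
  [Fintype W] {Λ : Type*} {d : Λ → ℕ} {ρ : ∀ l, MatrixRep L R K (d l)}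

theorem sum_repT_mul_repT_inv_of_ne (hρ : Function.Surjective (AlgHom.pi ρ)) {l m : Λ} (hlm : l ≠ m)
    (i j : Fin (d l)) (i' j' : Fin (d m)) :
    ∑ w : W, repT (ρ l) w i j * repT (ρ m) w⁻¹ i' j' = 0 := by
  classical
  obtain ⟨h, hh⟩ := hρ (Pi.single l 1)
  have hl : ρ l h = 1 := by simpa using congrFun hh l
  have hm : ρ m h = 0 := by simpa [Pi.single_eq_of_ne hlm.symm] using congrFun hh m
  have haverage := mul_average (ρ l) (ρ m) (.single j i' 1) h
  rw [hl, hm, Matrix.one_mul, Matrix.mul_zero] at haverage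
  rw [← average_single_apply, haverage, Matrix.zero_apply]

theorem exists_sum_repT_mul_repT_inv_eq {d : ℕ} {ρ : MatrixRep L R K d}
    (hρ : Function.Surjective ρ) : ∃ f : K, ∀ i j i' j' : Fin d,
      ∑ w : W, repT ρ w i j * repT ρ w⁻¹ i' j' = if i = j' ∧ j = i' then f else 0 := by
  have hscalar : ∀ φ, average ρ ρ φ ∈ Set.range (Matrix.scalar (Fin d)) := fun φ =>
    Matrix.mem_range_scalar_of_commute_single fun i j _ => by
      obtain ⟨h, hh⟩ := hρ (.single i j 1)
      exact hh ▸ mul_average ρ ρ φ h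
  choose c hc using fun j i' : Fin d => hscalar (.single j i' 1)
  have hsum : ∀ i j i' j', ∑ w : W, repT ρ w i j * repT ρ w⁻¹ i' j' =
      if i = j' then c j i' else 0 := fun i j i' j' => by
    rw [← average_single_apply, ← hc, Matrix.scalar_apply, Matrix.diagonal_apply]
  have hdiag : ∀ i j i', c j i' = if i' = j then c i i else 0 := fun i j i' => by
    rw [← hsum, sum_repT_mul_repT_inv_comm, hsum, if_pos rfl]
  rcases isEmpty_or_nonempty (Fin d) with hd | ⟨⟨i₀⟩⟩
  · exact ⟨0, fun i => hd.elim i⟩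
  · refine ⟨c i₀ i₀, fun i j i' j' => ?_⟩
    rw [hsum, hdiag i₀, ite_and]
    simp only [eq_comm]

theorem sum_repT_mul_repT_inv_self [CharZero K] {d : ℕ} {ρ : MatrixRep L R K d}
    (hρ : Function.Surjective ρ) (i j i' j' : Fin d) :
    ∑ w : W, repT ρ w i j * repT ρ w⁻¹ i' j' =
      if i = j' ∧ j = i' then schurElement ρ else 0 := by
  obtain ⟨f, hf⟩ := exists_sum_repT_mul_repT_inv_eq hρ
  have hd : (d : K) ≠ 0 := Nat.cast_ne_zero.mpr i.pos.ne'
  have htrace : ∑ w : W, (repT ρ w).trace * (repT ρ w⁻¹).trace = d * f :=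
    calc ∑ w : W, (repT ρ w).trace * (repT ρ w⁻¹).trace
        = ∑ k, ∑ k', ∑ w : W, repT ρ w k k * repT ρ w⁻¹ k' k' := by
          simp only [Matrix.trace, Matrix.diag_apply, Finset.sum_mul_sum]
          rw [Finset.sum_comm]
          exact Finset.sum_congr rfl fun k _ => Finset.sum_comm
      _ = d * f := by simp [hf]
  rw [hf, schurElement, htrace, inv_mul_cancel_left₀ hd]

theorem schurRelations_of_surjective [CharZero K] (hρ : Function.Surjective (AlgHom.pi ρ)) :
    SchurRelations (fun l => schurElement (ρ l)) (fun l => repT (ρ l)) where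
  sum_of_ne := sum_repT_mul_repT_inv_of_ne hρ
  sum_self l := sum_repT_mul_repT_inv_self ((Function.surjective_eval l).comp hρ)

end Orthogonality

end SchurRelations

section HahnEmbedding

theorem exists_eq_single_add {Γ F : Type*} [LinearOrder Γ] [Semiring F]
    {p : AddMonoidAlgebra F Γ} (hp : p ≠ 0) : ∃ (g : Γ) (r : F) (q : AddMonoidAlgebra F Γ),
      r ≠ 0 ∧ (∀ h ∈ q.coeff.support, g < h) ∧ p = .single g r + q := by
  classical
  have hne : p.coeff.support.Nonempty :=
    Finsupp.support_nonempty_iff.mpr fun h => hp (AddMonoidAlgebra.coeff_injective h)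
  refine ⟨p.coeff.support.min' hne, p.coeff _, p.erase _,
    Finsupp.mem_support_iff.mp (Finset.min'_mem _ hne), fun h hh => ?_,
    (AddMonoidAlgebra.single_add_erase _ p).symm⟩
  rw [AddMonoidAlgebra.coeff_erase, Finsupp.support_erase, Finset.mem_erase] at hh
  exact lt_of_le_of_ne (Finset.min'_le _ _ hh.2) hh.1.symm

variable {Γ : Type*} [AddCommGroup Γ] [LinearOrder Γ] [IsOrderedAddMonoid Γ]

theorem coeff_add_mul_of_le_orderTop {k : Type*} [CommRing k] {x y : HahnSeries Γ k} {a b : Γ}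
    (hx : a ≤ x.orderTop) (hy : b ≤ y.orderTop) :
    (x * y).coeff (a + b) = x.coeff a * y.coeff b := by
  have hle {z : HahnSeries Γ k} {c i : Γ} (hz : c ≤ z.orderTop) (hi : z.coeff i ≠ 0) : c ≤ i :=
    WithTop.coe_le_coe.mp (hz.trans (HahnSeries.orderTop_le_of_coeff_ne_zero hi))
  rw [HahnSeries.coeff_mul]
  refine Finset.sum_eq_single (a, b) (fun ij hij hne => (hne ?_).elim) fun hab => ?_
  · obtain ⟨hi, hj, hij⟩ := Finset.mem_antidiagonal.mp hij
    obtain ⟨h₁, h₂⟩ := (add_eq_add_iff_eq_and_eq (hle hx hi) (hle hy hj)).mp hij.symm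
    exact Prod.ext h₁.symm h₂.symm
  · by_contra h
    exact hab <| Finset.mem_antidiagonal.mpr
      ⟨left_ne_zero_of_mul h, right_ne_zero_of_mul h, rfl⟩

section GroupRing

variable {S k : Type*} [CommRing S] [CommRing k] (f : S →+* k)

/-- The inclusion of the group ring in the ring of Hahn series, with a change of coefficients. -/
noncomputable def hahnHom : AddMonoidAlgebra S Γ →+* HahnSeries Γ k :=
  AddMonoidAlgebra.liftNCRingHom (HahnSeries.C.comp f)
    { toFun := fun g => HahnSeries.single g.toAdd 1
      map_one' := rfl
      map_mul' := fun a b => by simp } fun _ _ => Commute.all _ _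

theorem hahnHom_single (g : Γ) (r : S) : hahnHom f (.single g r) = HahnSeries.single g (f r) :=
  (AddMonoidAlgebra.liftNC_single ..).trans (by simp)

theorem coeff_hahnHom (p : AddMonoidAlgebra S Γ) (g : Γ) :
    (hahnHom f p).coeff g = f (p.coeff g) := by
  classical
  induction p using AddMonoidAlgebra.induction_linear with
  | zero => simp
  | add p q hp hq => simp [hp, hq]
  | single h r =>
    rw [hahnHom_single, HahnSeries.coeff_single, AddMonoidAlgebra.coeff_single,
      Finsupp.single_apply, apply_ite f, map_zero]
    split_ifs <;> simp_all

theorem lt_orderTop_hahnHom {p : AddMonoidAlgebra S Γ} {g : Γ}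
    (hp : ∀ h ∈ p.coeff.support, g < h) : g < (hahnHom f p).orderTop := by
  by_contra! hle
  obtain ⟨h, hh⟩ := WithTop.ne_top_iff_exists.mp (hle.trans_lt (WithTop.coe_lt_top g)).ne
  have hcoeff := HahnSeries.coeff_orderTop_ne hh.symm
  rw [coeff_hahnHom] at hcoeff
  rw [← hh, WithTop.coe_le_coe] at hle
  exact hle.not_gt (hp h (Finsupp.mem_support_iff.mpr (ne_zero_of_map hcoeff)))

variable {f}

theorem hahnHom_injective (hf : Function.Injective f) :
    Function.Injective (hahnHom (Γ := Γ) f) := fun p q h =>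
  AddMonoidAlgebra.coeff_injective <| Finsupp.ext fun g => hf <| by
    rw [← coeff_hahnHom, h, coeff_hahnHom]

end GroupRing

theorem orderTop_hahnHom_one_add {F k : Type*} [Field F] [Field k] (ι : F →+* k)
    {p : AddMonoidAlgebra F Γ} (hp : PosSupport p) : (hahnHom ι (1 + p)).orderTop = 0 := by
  refine ((HahnSeries.orderTop_self_sub_one_pos_iff _).mp ?_).1
  rw [map_add, map_one, add_sub_cancel_left]
  exact lt_orderTop_hahnHom ι hp

theorem exists_eq_single_mul_one_add {F : Type*} [Field F] {p : AddMonoidAlgebra F Γ}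
    (hp : p ≠ 0) : ∃ (g : Γ) (r : F) (q : AddMonoidAlgebra F Γ), r ≠ 0 ∧ PosSupport q ∧
      p = .single g r * (1 + q) := by
  obtain ⟨g, r, q, hr, hq, rfl⟩ := exists_eq_single_add hp
  refine ⟨g, r, .single (-g) r⁻¹ * q, hr, fun h hh => ?_, ?_⟩
  · rw [Finsupp.mem_support_iff, AddMonoidAlgebra.coeff_single_mul_apply, neg_neg] at hh
    exact pos_of_lt_add_right (hq _ (Finsupp.mem_support_iff.mpr (right_ne_zero_of_mul hh)))
  · rw [mul_add, mul_one, ← mul_assoc, AddMonoidAlgebra.single_mul_single, add_neg_cancel,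
      mul_inv_cancel₀ hr, ← AddMonoidAlgebra.one_def, one_mul]

variable (R : Type*) [CommRing R] {F : Type*} [Field F] [Algebra R F]
  [IsFractionRing R F] (K : Type*) [Field K] [Algebra (AddMonoidAlgebra R Γ) K]
  [IsFractionRing (AddMonoidAlgebra R Γ) K] {k : Type*} [Field k] (ι : F →+* k)

/-- The embedding of `K = Frac R[Γ]` in the field of Hahn series with coefficients in an extension
of `F = Frac R`. The valuation that defines `𝒪` is the restriction of the order of Hahn series. -/
noncomputable def hahnEmb : K →+* HahnSeries Γ k :=
  IsFractionRing.lift (A := AddMonoidAlgebra R Γ) <|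
    hahnHom_injective (f := ι.comp (algebraMap R F)) <|
      ι.injective.comp (IsFractionRing.injective R F)

theorem hahnEmb_algebraMap (p : AddMonoidAlgebra R Γ) :
    hahnEmb R K ι (algebraMap (AddMonoidAlgebra R Γ) K p) =
      hahnHom (ι.comp (algebraMap R F)) p :=
  IsFractionRing.lift_algebraMap _ _

theorem hahnEmb_eps (g : Γ) : hahnEmb R K ι (eps R K g) = HahnSeries.single g 1 := by
  rw [eps, hahnEmb_algebraMap, hahnHom_single, map_one]

variable [IsDomain R]

theorem hahnEmb_scalarHom (r : F) :
    hahnEmb (Γ := Γ) R K ι (scalarHom Γ R F K r) = HahnSeries.C (ι r) := by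
  have hcomp : (hahnEmb (Γ := Γ) R K ι).comp (scalarHom Γ R F K) = HahnSeries.C.comp ι := by
    refine IsLocalization.ringHom_ext (nonZeroDivisors R) (RingHom.ext fun r => ?_)
    simp only [RingHom.comp_apply, scalarHom, IsFractionRing.lift_algebraMap, hahnEmb_algebraMap]
    exact hahnHom_single _ _ _
  exact RingHom.congr_fun hcomp r

variable {R K} in
theorem laurentHom_single (g : Γ) (r : F) :
    laurentHom R F K (.single g r) = scalarHom Γ R F K r * eps R K g :=
  AddMonoidAlgebra.liftNC_single ..

theorem hahnEmb_laurentHom (p : AddMonoidAlgebra F Γ) :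
    hahnEmb R K ι (laurentHom R F K p) = hahnHom ι p := by
  induction p using AddMonoidAlgebra.induction_linear with
  | zero => simp
  | add p q hp hq => simp [hp, hq]
  | single g r =>
    rw [laurentHom_single, map_mul, hahnEmb_scalarHom, hahnEmb_eps, hahnHom_single,
      HahnSeries.C_apply, HahnSeries.single_mul_single, zero_add, mul_one]

variable {R K}

theorem laurentHom_mapRingHom (p : AddMonoidAlgebra R Γ) :
    laurentHom R F K (AddMonoidAlgebra.mapRingHom Γ (algebraMap R F) p) =
      algebraMap (AddMonoidAlgebra R Γ) K p := by
  refine (hahnEmb (Γ := Γ) R K (RingHom.id F)).injective (HahnSeries.ext (funext fun g => ?_))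
  rw [hahnEmb_laurentHom, hahnEmb_algebraMap, coeff_hahnHom, coeff_hahnHom]
  simp

theorem orderTop_hahnEmb_of_hasNormalForm {x : K} {r : F} {g : Γ} (h : HasNormalForm R F x r g) :
    (hahnEmb R K ι x).orderTop = (HahnSeries.single g (ι r)).orderTop := by
  obtain ⟨p, q, hp, hq, rfl⟩ := h
  have hq₀ : hahnHom ι (1 + q) ≠ 0 := by
    rw [← HahnSeries.orderTop_ne_top, orderTop_hahnHom_one_add ι hq]
    exact WithTop.zero_ne_top
  have hmul : hahnEmb R K ι (scalarHom Γ R F K r * eps R K g *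
      (laurentHom R F K (1 + p) / laurentHom R F K (1 + q))) * hahnHom ι (1 + q) =
      HahnSeries.single g (ι r) * hahnHom ι (1 + p) := by
    rw [map_mul, map_mul, map_div₀, hahnEmb_laurentHom, hahnEmb_laurentHom, hahnEmb_scalarHom,
      hahnEmb_eps, mul_assoc, div_mul_cancel₀ _ hq₀, HahnSeries.C_apply,
      HahnSeries.single_mul_single, zero_add, mul_one]
  simpa only [HahnSeries.orderTop_mul, orderTop_hahnHom_one_add ι hp,
    orderTop_hahnHom_one_add ι hq, add_zero] using congrArg HahnSeries.orderTop hmul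

variable (Γ R F) in
theorem exists_hasNormalForm {x : K} (hx : x ≠ 0) :
    ∃ (r : F) (g : Γ), r ≠ 0 ∧ HasNormalForm R F x r g := by
  have hfactor {p : AddMonoidAlgebra R Γ} (hp : algebraMap _ K p ≠ 0) :
      ∃ (g : Γ) (r : F) (q : AddMonoidAlgebra F Γ), r ≠ 0 ∧ PosSupport q ∧
        algebraMap _ K p = scalarHom Γ R F K r * eps R K g * laurentHom R F K (1 + q) := by
    rw [← laurentHom_mapRingHom (F := F)] at hp ⊢
    obtain ⟨g, r, q, hr, hq, h⟩ := exists_eq_single_mul_one_add (ne_zero_of_map hp)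
    exact ⟨g, r, q, hr, hq, by rw [h, map_mul, laurentHom_single]⟩
  obtain ⟨a, b, -, rfl⟩ := IsFractionRing.div_surjective (A := AddMonoidAlgebra R Γ) x
  obtain ⟨ha, hb⟩ := div_ne_zero_iff.mp hx
  obtain ⟨g, r, p, hr, hp, hap⟩ := hfactor ha
  obtain ⟨h, s, q, hs, hq, hbq⟩ := hfactor hb
  have heps : eps R K g = eps R K (g - h) * eps R K h := by
    rw [eps, eps, eps, ← map_mul, AddMonoidAlgebra.single_mul_single, sub_add_cancel, one_mul]
  refine ⟨r / s, g - h, div_ne_zero hr hs, p, q, hp, hq, ?_⟩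
  rw [hbq] at hb
  rw [hap, hbq, map_div₀, heps]
  have h₁ := left_ne_zero_of_mul (left_ne_zero_of_mul hb)
  have h₂ := right_ne_zero_of_mul (left_ne_zero_of_mul hb)
  field_simp

theorem eq_zero_or_exists_hasNormalForm_iff {x : K} {P : Γ → Prop} :
    (x = 0 ∨ ∃ (r : F) (g : Γ), P g ∧ HasNormalForm R F x r g) ↔
      ∀ g : Γ, (hahnEmb (Γ := Γ) R K ι x).orderTop = g → P g := by
  refine ⟨?_, fun h => or_iff_not_imp_left.mpr fun hx => ?_⟩
  · rintro (rfl | ⟨r, g, hg, h⟩) g' hg'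
    · simp at hg'
    · rw [orderTop_hahnEmb_of_hasNormalForm ι h] at hg'
      have hr : HahnSeries.single g (ι r) ≠ 0 :=
        HahnSeries.orderTop_ne_top.mp (hg' ▸ WithTop.coe_ne_top)
      rw [HahnSeries.orderTop_single (ne_zero_of_map hr)] at hg'
      exact WithTop.coe_injective hg' ▸ hg
  · obtain ⟨r, g, hr, hrg⟩ := exists_hasNormalForm Γ R F hx
    refine ⟨r, g, h g ?_, hrg⟩
    rw [orderTop_hahnEmb_of_hasNormalForm ι hrg,
      HahnSeries.orderTop_single ((map_ne_zero ι).mpr hr)]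

theorem mem_valRing_iff {x : K} :
    x ∈ valRing Γ R F K ↔ 0 ≤ (hahnEmb (Γ := Γ) R K ι x).orderTop := by
  refine (eq_zero_or_exists_hasNormalForm_iff ι).trans ?_
  cases (hahnEmb (Γ := Γ) R K ι x).orderTop <;> simp

theorem mem_valIdeal_iff {x : K} :
    x ∈ valIdeal Γ R F K ↔ 0 < (hahnEmb (Γ := Γ) R K ι x).orderTop := by
  refine (eq_zero_or_exists_hasNormalForm_iff ι).trans ?_
  cases (hahnEmb (Γ := Γ) R K ι x).orderTop <;> simp

theorem constTerm_eq_coeff {x : K} (hx : x ∈ valRing Γ R F K) :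
    constTerm Γ R F x = (hahnEmb (Γ := Γ) R K (RingHom.id F) x).coeff 0 := by
  rw [mem_valRing_iff (RingHom.id F)] at hx
  have hmem {r : F} : x - scalarHom Γ R F K r ∈ valIdeal Γ R F K ↔
      r = (hahnEmb (Γ := Γ) R K (RingHom.id F) x).coeff 0 := by
    have hcoeff : (hahnEmb (Γ := Γ) R K (RingHom.id F) x - HahnSeries.C r).coeff 0 =
        (hahnEmb (Γ := Γ) R K (RingHom.id F) x).coeff 0 - r := by simp
    rw [mem_valIdeal_iff (RingHom.id F), map_sub, hahnEmb_scalarHom, RingHom.id_apply, eq_comm,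
      ← sub_eq_zero, ← hcoeff]
    refine ⟨fun h => HahnSeries.coeff_eq_zero_of_lt_orderTop h, fun h => ?_⟩
    exact lt_of_le_of_ne ((le_min hx HahnSeries.orderTop_single_le).trans
      HahnSeries.min_orderTop_le_orderTop_sub) (HahnSeries.orderTop_ne_of_coeff_eq_zero h).symm
  exact hmem.mp <| Classical.epsilon_spec
    (p := fun r : F => x - scalarHom Γ R F K r ∈ valIdeal Γ R F K) ⟨_, hmem.mpr rfl⟩

variable (K) in
theorem exists_hasLowestTerm {p : AddMonoidAlgebra F Γ} (hp : p ≠ 0) :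
    ∃ (g : Γ) (r : F), HasLowestTerm R F (laurentHom R F K p) g r := by
  obtain ⟨g, r, q, hr, hq, rfl⟩ := exists_eq_single_add hp
  exact ⟨g, r, hr, q, hq, by rw [map_add, laurentHom_single]⟩

namespace HasLowestTerm

variable {c : K} {g g' : Γ} {r r' : F}

theorem hahnEmb_eq (h : HasLowestTerm R F c g r) : ∃ y : HahnSeries Γ k, g < y.orderTop ∧
    hahnEmb R K ι c = HahnSeries.single g (ι r) + y := by
  obtain ⟨-, q, hq, rfl⟩ := h
  refine ⟨hahnHom ι q, lt_orderTop_hahnHom ι hq, ?_⟩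
  rw [map_add, map_mul, hahnEmb_scalarHom, hahnEmb_eps, hahnEmb_laurentHom, HahnSeries.C_apply,
    HahnSeries.single_mul_single, zero_add, mul_one]

theorem orderTop_hahnEmb (h : HasLowestTerm R F c g r) :
    (hahnEmb R K ι c).orderTop = (g : WithTop Γ) := by
  obtain ⟨y, hy, hc⟩ := h.hahnEmb_eq ι
  have hg := HahnSeries.orderTop_single (a := g) ((map_ne_zero ι).mpr h.1)
  rw [hc, HahnSeries.orderTop_add_eq_left (hg.trans_lt hy), hg]

theorem coeff_hahnEmb (h : HasLowestTerm R F c g r) : (hahnEmb R K ι c).coeff g = ι r := by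
  obtain ⟨y, hy, hc⟩ := h.hahnEmb_eq ι
  rw [hc, HahnSeries.coeff_add, HahnSeries.coeff_single_same,
    HahnSeries.coeff_eq_zero_of_lt_orderTop hy, add_zero]

theorem unique (h : HasLowestTerm R F c g r) (h' : HasLowestTerm R F c g' r') :
    g = g' ∧ r = r' := by
  obtain rfl : g = g' := WithTop.coe_injective <|
    (h.orderTop_hahnEmb (RingHom.id F)).symm.trans (h'.orderTop_hahnEmb (RingHom.id F))
  exact ⟨rfl, (h.coeff_hahnEmb (RingHom.id F)).symm.trans (h'.coeff_hahnEmb (RingHom.id F))⟩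

end HasLowestTerm

end HahnEmbedding

section SchurElements

open HeckeAlgebra Matrix

variable {Γ : Type*} [AddCommGroup Γ] [LinearOrder Γ] [IsOrderedAddMonoid Γ]

section Star

variable {k : Type*} [CommRing k] [StarRing k]

/-- Hahn series with the coefficientwise involution. -/
noncomputable instance : StarRing (HahnSeries Γ k) where
  star x := x.map (starRingEnd k)
  star_involutive x := by ext; simp
  star_mul x y := by
    rw [mul_comm x y]
    exact HahnSeries.map_mul (starRingEnd k : k →ₙ+* k)
  star_add x y := by ext; simp

theorem coeff_star (x : HahnSeries Γ k) (g : Γ) : (star x).coeff g = star (x.coeff g) := rfl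

theorem orderTop_star (x : HahnSeries Γ k) : (star x).orderTop = x.orderTop := by
  have hle (y : HahnSeries Γ k) : y.orderTop ≤ (star y).orderTop :=
    HahnSeries.le_orderTop_iff_forall.mpr fun j hj => by
      rw [coeff_star, HahnSeries.coeff_eq_zero_of_lt_orderTop hj, star_zero]
  exact le_antisymm ((hle (star x)).trans_eq (by rw [star_star])) (hle x)

theorem star_single (g : Γ) (r : k) :
    star (HahnSeries.single g r) = HahnSeries.single g (star r) := by
  classical
  ext h
  rw [coeff_star, HahnSeries.coeff_single, HahnSeries.coeff_single, apply_ite star, star_zero]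

end Star

variable {𝕜 : Type*} [RCLike 𝕜]

-- The coefficient of the sum at twice the least order of the `x i` is a sum of squares `|z|²`.
theorem exists_orderTop_sum_mul_star {I : Type*} [Fintype I] {x : I → HahnSeries Γ 𝕜}
    (hx : ∃ i, x i ≠ 0) :
    ∃ a : Γ, (∑ i, x i * star (x i)).orderTop = ((a + a : Γ) : WithTop Γ) := by
  obtain ⟨i₀, hi₀⟩ := hx
  obtain ⟨m, -, hm⟩ := Finset.univ.exists_min_image (fun i => (x i).orderTop) ⟨i₀, by simp⟩
  obtain ⟨a, ha⟩ := WithTop.ne_top_iff_exists.mp <|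
    ((hm i₀ (by simp)).trans_lt (HahnSeries.orderTop_lt_top.mpr hi₀)).ne
  have hle (i : I) : a ≤ (x i).orderTop := ha ▸ hm i (by simp)
  have hle_star (i : I) : a ≤ (star (x i)).orderTop := (hle i).trans_eq (orderTop_star _).symm
  have hcoeff : (∑ i, x i * star (x i)).coeff (a + a) =
      ((∑ i, ‖(x i).coeff a‖ ^ 2 : ℝ) : 𝕜) := by
    rw [HahnSeries.coeff_sum, RCLike.ofReal_sum]
    refine Finset.sum_congr rfl fun i _ => ?_
    rw [coeff_add_mul_of_le_orderTop (hle i) (hle_star i), coeff_star, RCLike.ofReal_pow]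
    exact RCLike.mul_conj _
  have hpos : 0 < ∑ i, ‖(x i).coeff a‖ ^ 2 :=
    Finset.sum_pos' (fun i _ => sq_nonneg _) ⟨m, Finset.mem_univ _,
      pow_pos (norm_pos_iff.mpr (HahnSeries.coeff_orderTop_ne ha.symm)) 2⟩
  refine ⟨a, le_antisymm (HahnSeries.orderTop_le_of_coeff_ne_zero ?_)
    (HahnSeries.le_orderTop_iff_forall.mpr fun j hj => ?_)⟩
  · rw [hcoeff]
    exact_mod_cast hpos.ne'
  · rw [HahnSeries.coeff_sum]
    refine Finset.sum_eq_zero fun i _ => HahnSeries.coeff_eq_zero_of_lt_orderTop ?_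
    exact hj.trans_le ((add_le_add (hle i) (hle_star i)).trans HahnSeries.orderTop_add_le_mul)

theorem sum_mul_star_ne_zero {I : Type*} [Fintype I] {x : I → HahnSeries Γ 𝕜}
    (hx : ∃ i, x i ≠ 0) : ∑ i, x i * star (x i) ≠ 0 := by
  obtain ⟨a, ha⟩ := exists_orderTop_sum_mul_star hx
  exact HahnSeries.orderTop_ne_top.mp (ha ▸ WithTop.coe_ne_top)

variable {B W : Type*} [Group W] {M : CoxeterMatrix B} {cs : CoxeterSystem M W}
  {L : WeightFunction cs Γ} {R : Type*} [CommRing R] {F : Type*} [Field F] [Algebra R F]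
  [IsFractionRing R F] {K : Type*} [Field K] [Algebra (AddMonoidAlgebra R Γ) K]
  [IsFractionRing (AddMonoidAlgebra R Γ) K] {d : ℕ} (ι : F →+* 𝕜) (ρ : MatrixRep L R K d)

/-- The matrix `ρ(T_w)` over the field of Hahn series. -/
noncomputable def hahnRepT (w : W) : Matrix (Fin d) (Fin d) (HahnSeries Γ 𝕜) :=
  (repT ρ w).map (hahnEmb R K ι)

theorem hahnRepT_one : hahnRepT ι ρ (1 : W) = 1 := by
  rw [hahnRepT, repT_one, Matrix.map_one _ (map_zero _) (map_one _)]

theorem trace_hahnRepT (w : W) :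
    (hahnRepT ι ρ w).trace = hahnEmb R K ι (repT ρ w).trace :=
  (AddMonoidHom.map_trace (hahnEmb R K ι).toAddMonoidHom _).symm

theorem hahnRepT_simple_mul_of_lt {i : B} {w : W}
    (h : cs.length w < cs.length (cs.simple i * w)) :
    hahnRepT ι ρ (cs.simple i * w) = hahnRepT ι ρ (cs.simple i) * hahnRepT ι ρ w := by
  rw [hahnRepT, repT_simple_mul_of_lt ρ h, Matrix.map_mul]
  rfl

theorem star_hahnHom_heckeParam {k : Type*} [CommRing k] [StarRing k] (f : R →+* k) (i : B) :
    star (hahnHom f (heckeParam L R i)) = hahnHom f (heckeParam L R i) := by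
  rw [heckeParam, map_sub, hahnHom_single, hahnHom_single, star_sub, star_single, star_single,
    map_one, star_one]

open Classical in
theorem hahnRepT_mul_simple (w : W) (i : B) :
    hahnRepT ι ρ w * hahnRepT ι ρ (cs.simple i) = hahnRepT ι ρ (w * cs.simple i) +
      (if cs.length w < cs.length (w * cs.simple i) then 0
        else hahnHom (ι.comp (algebraMap R F)) (heckeParam L R i)) • hahnRepT ι ρ w := by
  have h := congrArg (fun h => (repH ρ h).map (hahnEmb (Γ := Γ) R K ι)) (T_mul_T_simple L R w i)
  simp only [map_mul, map_add, map_smul, repH_T, Matrix.map_mul] at h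
  refine h.trans (Matrix.ext fun a b => ?_)
  simp only [hahnRepT, Matrix.map_apply, Matrix.add_apply, Matrix.smul_apply, map_add]
  rw [Algebra.smul_def, map_mul, hahnEmb_algebraMap, apply_ite (hahnHom _), map_zero, smul_eq_mul]

theorem hahnRepT_mul_simple_of_lt {i : B} {w : W}
    (h : cs.length w < cs.length (w * cs.simple i)) :
    hahnRepT ι ρ (w * cs.simple i) = hahnRepT ι ρ w * hahnRepT ι ρ (cs.simple i) := by
  rw [hahnRepT_mul_simple, if_pos h, zero_smul, add_zero]

variable [Fintype W]

section InvariantForm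

variable {𝕃 : Type*} [CommRing 𝕃] [StarRing 𝕃]

/-- The matrix of the form obtained by summing the translates of the standard Hermitian form under
the matrices `N w`. -/
def invariantForm (N : W → Matrix (Fin d) (Fin d) 𝕃) : Matrix (Fin d) (Fin d) 𝕃 :=
  ∑ w : W, (N w)ᴴ * N w

theorem invariantForm_mul_eq_conjTranspose_mul {N : W → Matrix (Fin d) (Fin d) 𝕃} {s : W}
    (hs : s * s = 1) {ξ : W → 𝕃} (hξ : ∀ w, star (ξ w) = ξ w)
    (hN : ∀ w, N w * N s = N (w * s) + ξ w • N w) :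
    invariantForm N * N s = (N s)ᴴ * invariantForm N := by
  have hleft : ∀ w, (N w)ᴴ * N w * N s = (N w)ᴴ * N (w * s) + ξ w • ((N w)ᴴ * N w) := fun w => by
    rw [Matrix.mul_assoc, hN, Matrix.mul_add, Matrix.mul_smul]
  have hright : ∀ w, (N s)ᴴ * ((N w)ᴴ * N w) =
      (N (w * s))ᴴ * N w + ξ w • ((N w)ᴴ * N w) := fun w => by
    rw [← Matrix.mul_assoc, ← conjTranspose_mul, hN, conjTranspose_add, conjTranspose_smul, hξ,
      Matrix.add_mul, Matrix.smul_mul]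
  simp only [invariantForm, Matrix.sum_mul, Matrix.mul_sum, hleft, hright, Finset.sum_add_distrib]
  congr 1
  exact Fintype.sum_equiv (Equiv.mulRight s) _ _ fun w => by simp [mul_assoc, hs]

end InvariantForm

theorem invariantForm_mul_hahnRepT (w : W) :
    invariantForm (hahnRepT ι ρ) * hahnRepT ι ρ w =
      (hahnRepT ι ρ w⁻¹)ᴴ * invariantForm (hahnRepT ι ρ) := by
  classical
  induction w using simple_mul_induction cs with
  | one => simp only [hahnRepT_one, inv_one, conjTranspose_one, Matrix.mul_one, Matrix.one_mul]
  | simple_mul i w hw ih =>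
    have hsimple := invariantForm_mul_eq_conjTranspose_mul (cs.simple_mul_simple_self i)
      (fun w => by rw [apply_ite star, star_zero, star_hahnHom_heckeParam])
      (hahnRepT_mul_simple ι ρ · i)
    have hw' : cs.length w⁻¹ < cs.length (w⁻¹ * cs.simple i) := by
      rwa [cs.length_inv, ← cs.length_inv (w⁻¹ * cs.simple i), _root_.mul_inv_rev, inv_inv,
        cs.inv_simple]
    rw [hahnRepT_simple_mul_of_lt ι ρ hw, ← Matrix.mul_assoc, hsimple, Matrix.mul_assoc, ih,
      ← Matrix.mul_assoc, ← conjTranspose_mul, ← hahnRepT_mul_simple_of_lt ι ρ hw',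
      _root_.mul_inv_rev, cs.inv_simple]

theorem det_invariantForm_hahnRepT_ne_zero : (invariantForm (hahnRepT ι ρ)).det ≠ 0 := by
  refine fun hdet => ?_
  obtain ⟨v, hv, hHv⟩ := Matrix.exists_mulVec_eq_zero_iff.mpr hdet
  obtain ⟨b, hb⟩ := Function.ne_iff.mp hv
  refine sum_mul_star_ne_zero (x := fun p : W × Fin d => (hahnRepT ι ρ p.1 *ᵥ v) p.2)
    ⟨(1, b), by rwa [hahnRepT_one, Matrix.one_mulVec]⟩ ?_
  calc ∑ p : W × Fin d, (hahnRepT ι ρ p.1 *ᵥ v) p.2 * star ((hahnRepT ι ρ p.1 *ᵥ v) p.2)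
      = ∑ w, star (hahnRepT ι ρ w *ᵥ v) ⬝ᵥ (hahnRepT ι ρ w *ᵥ v) := by
        simp only [Fintype.sum_prod_type, dotProduct, Pi.star_apply, mul_comm]
    _ = star v ⬝ᵥ (invariantForm (hahnRepT ι ρ) *ᵥ v) := by
        simp only [invariantForm, Matrix.sum_mulVec, dotProduct_sum, star_mulVec,
          dotProduct_mulVec, vecMul_vecMul]
    _ = 0 := by rw [hHv, dotProduct_zero]

omit [Fintype W] in
theorem star_trace_hahnRepT [Finite W] (w : W) :
    star (hahnRepT ι ρ w).trace = (hahnRepT ι ρ w⁻¹).trace := by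
  cases nonempty_fintype W
  have hunit : IsUnit (invariantForm (hahnRepT ι ρ)).det :=
    (det_invariantForm_hahnRepT_ne_zero ι ρ).isUnit
  have hconj : (hahnRepT ι ρ w)ᴴ = invariantForm (hahnRepT ι ρ) * hahnRepT ι ρ w⁻¹ *
      (invariantForm (hahnRepT ι ρ))⁻¹ := by
    rw [invariantForm_mul_hahnRepT, inv_inv, Matrix.mul_nonsing_inv_cancel_right _ _ hunit]
  rw [← trace_conjTranspose, hconj, trace_mul_comm, Matrix.nonsing_inv_mul_cancel_left _ _ hunit]

theorem exists_orderTop_hahnEmb_schurElement (hd : d ≠ 0) : ∃ a : Γ,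
    (hahnEmb (Γ := Γ) R K ι (schurElement ρ)).orderTop = ((a + a : Γ) : WithTop Γ) := by
  have hd' : (d : 𝕜) ≠ 0 := Nat.cast_ne_zero.mpr hd
  obtain ⟨a, ha⟩ := exists_orderTop_sum_mul_star (x := fun w => (hahnRepT ι ρ w).trace)
    ⟨1, by rw [hahnRepT_one, Matrix.trace_one, Fintype.card_fin,
      ← map_natCast (HahnSeries.C : 𝕜 →+* HahnSeries Γ 𝕜)]; exact HahnSeries.C_ne_zero hd'⟩
  refine ⟨a, ?_⟩
  have hsum : hahnEmb (Γ := Γ) R K ι (schurElement ρ) =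
      HahnSeries.C (d : 𝕜)⁻¹ * ∑ w, (hahnRepT ι ρ w).trace * star (hahnRepT ι ρ w).trace := by
    simp only [star_trace_hahnRepT]
    simp only [schurElement, trace_hahnRepT, map_mul, map_sum, map_inv₀, map_natCast]
  rw [hsum, HahnSeries.orderTop_mul, ha, HahnSeries.C_apply,
    HahnSeries.orderTop_single (inv_ne_zero hd'), WithTop.coe_zero, zero_add]

theorem exists_laurentHom_eq_schurElement [IsDomain R] (hρ : ∀ w, (repT ρ w).trace ∈
    Set.range (algebraMap (AddMonoidAlgebra R Γ) K)) :
    ∃ p : AddMonoidAlgebra F Γ, laurentHom R F K p = schurElement ρ := by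
  choose a ha using hρ
  have hd : laurentHom R F K (.single (0 : Γ) (d : F)⁻¹) = (d : K)⁻¹ := by
    rw [laurentHom_single, map_inv₀, map_natCast, eps, ← AddMonoidAlgebra.one_def, map_one, mul_one]
  refine ⟨.single 0 (d : F)⁻¹ *
    AddMonoidAlgebra.mapRingHom Γ (algebraMap R F) (∑ w, a w * a w⁻¹), ?_⟩
  simp only [map_mul, hd, laurentHom_mapRingHom, map_sum, ha, schurElement]

include ι in
theorem hasLowestTerm_schurElement [IsDomain R] (hd : d ≠ 0) (hρ : ∀ w, (repT ρ w).trace ∈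
    Set.range (algebraMap (AddMonoidAlgebra R Γ) K)) :
    HasLowestTerm R F (schurElement ρ) (-(2 • aInv F ρ)) (fInv F ρ) := by
  obtain ⟨α, hα⟩ := exists_orderTop_hahnEmb_schurElement ι ρ hd
  obtain ⟨p, hp⟩ := exists_laurentHom_eq_schurElement (F := F) ρ hρ
  have hp₀ : p ≠ 0 := fun h => WithTop.coe_ne_top <| by
    rw [← hα, ← hp, h, map_zero, map_zero, HahnSeries.orderTop_zero]
  obtain ⟨g, r, hgr⟩ : ∃ g r, HasLowestTerm R F (schurElement ρ) g r :=
    hp ▸ exists_hasLowestTerm K hp₀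
  have hg : g = -(2 • -α) := by
    rw [smul_neg, neg_neg, two_nsmul]
    exact WithTop.coe_injective ((hgr.orderTop_hahnEmb ι).symm.trans hα)
  rw [hg] at hgr
  obtain ⟨r', hr'⟩ : ∃ r', HasLowestTerm R F (schurElement ρ) (-(2 • aInv F ρ)) r' :=
    Classical.epsilon_spec (p := fun a : Γ => ∃ r', HasLowestTerm R F _ (-(2 • a)) r')
      ⟨-α, r, hgr⟩
  obtain ⟨a', ha'⟩ : ∃ a' : Γ, HasLowestTerm R F (schurElement ρ) (-(2 • a')) (fInv F ρ) :=
    Classical.epsilon_spec (p := fun r' : F => ∃ a' : Γ, HasLowestTerm R F _ (-(2 • a')) r')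
      ⟨r, -α, hgr⟩
  rwa [← (hr'.unique ha').2]

end SchurElements

section JRing

open Matrix

section Reconstruction

variable {W Λ k : Type*} [Group W] [Fintype W] [Field k] {d : Λ → ℕ} {f : Λ → k}
  {c : ∀ l, W → Matrix (Fin (d l)) (Fin (d l)) k}

theorem sum_trace_mul_smul_apply (l m : Λ) (X : Matrix (Fin (d l)) (Fin (d l)) k)
    (a b : Fin (d m)) :
    (∑ w, (X * c l w⁻¹).trace • c m w) a b =
      ∑ i, ∑ j, X i j * ∑ w, c m w a b * c l w⁻¹ j i := by
  simp only [Matrix.sum_apply, Matrix.smul_apply, smul_eq_mul, Matrix.trace, Matrix.diag_apply,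
    Matrix.mul_apply, Finset.sum_mul, Finset.mul_sum]
  rw [Finset.sum_comm.trans (Finset.sum_congr rfl fun i _ => Finset.sum_comm)]
  refine Finset.sum_congr rfl fun i _ => Finset.sum_congr rfl fun j _ =>
    Finset.sum_congr rfl fun w _ => ?_
  rw [mul_assoc, mul_comm (c l w⁻¹ j i)]

theorem SchurRelations.sum_trace_mul_smul_of_ne (h : SchurRelations f c) {l m : Λ} (hlm : l ≠ m)
    (X : Matrix (Fin (d l)) (Fin (d l)) k) : ∑ w, (X * c l w⁻¹).trace • c m w = 0 := by
  ext a b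
  simp [sum_trace_mul_smul_apply, h.sum_of_ne hlm.symm]

theorem SchurRelations.sum_trace_mul_smul_self (h : SchurRelations f c) (l : Λ)
    (X : Matrix (Fin (d l)) (Fin (d l)) k) : ∑ w, (X * c l w⁻¹).trace • c l w = f l • X := by
  ext a b
  simp [sum_trace_mul_smul_apply, h.sum_self, ite_and, mul_comm]

theorem SchurRelations.sum_sum_trace_smul_eq [Fintype Λ] (h : SchurRelations f c)
    (hf : ∀ l, f l ≠ 0) (X : ∀ l, Matrix (Fin (d l)) (Fin (d l)) k) (m : Λ) :
    ∑ w, (∑ l, (f l)⁻¹ * (X l * c l w⁻¹).trace) • c m w = X m := by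
  calc ∑ w, (∑ l, (f l)⁻¹ * (X l * c l w⁻¹).trace) • c m w
      = ∑ l, (f l)⁻¹ • ∑ w, (X l * c l w⁻¹).trace • c m w := by
        simp only [Finset.sum_smul, Finset.smul_sum, mul_smul]
        exact Finset.sum_comm
    _ = (f m)⁻¹ • f m • X m := by
        rw [Finset.sum_eq_single m (fun l _ hlm => by
          rw [h.sum_trace_mul_smul_of_ne hlm, smul_zero]) (by simp), h.sum_trace_mul_smul_self]
    _ = X m := inv_smul_smul₀ (hf m) _

end Reconstruction

variable {B W : Type*} [Group W] [Fintype W] {M : CoxeterMatrix B} {cs : CoxeterSystem M W}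
  {Γ : Type*} [AddCommGroup Γ] [LinearOrder Γ] [IsOrderedAddMonoid Γ]
  {L : WeightFunction cs Γ} {R : Type*} [CommRing R]
  {F : Type*} [Field F] [Algebra R F] [IsFractionRing R F]
  {K : Type*} [Field K] [Algebra (AddMonoidAlgebra R Γ) K]
  [IsFractionRing (AddMonoidAlgebra R Γ) K]

section LeadingMatrices

theorem hahnEmb_neg_one_pow_mul_eps_mul {k : Type*} [Field k] (ι : F →+* k) (n : ℕ) (g : Γ)
    (x : K) : hahnEmb R K ι ((-1) ^ n * eps R K g * x) =
      HahnSeries.single g ((-1) ^ n) * hahnEmb R K ι x := by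
  have hsign : ((-1) ^ n : HahnSeries Γ k) = HahnSeries.C ((-1) ^ n) := by
    rw [map_pow, map_neg, map_one]
  rw [map_mul, map_mul, hahnEmb_eps, map_pow, map_neg, map_one, hsign, HahnSeries.C_apply,
    HahnSeries.single_mul_single, zero_add, mul_one]

variable [IsDomain R]

theorem neg_one_pow_mul_eps_mul_mem_valRing_iff {k : Type*} [Field k] (ι : F →+* k) (n : ℕ)
    {g : Γ} {x : K} : (-1) ^ n * eps R K g * x ∈ valRing Γ R F K ↔
      ((-g : Γ) : WithTop Γ) ≤ (hahnEmb (Γ := Γ) R K ι x).orderTop := by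
  have hsign : ((-1) ^ n : k) ≠ 0 := pow_ne_zero n (neg_ne_zero.mpr one_ne_zero)
  rw [mem_valRing_iff ι, hahnEmb_neg_one_pow_mul_eps_mul, HahnSeries.orderTop_mul,
    HahnSeries.orderTop_single hsign]
  cases (hahnEmb (Γ := Γ) R K ι x).orderTop with
  | top => simp
  | coe h => norm_cast; exact neg_le_iff_add_nonneg'.symm

section

variable {d : ℕ} {ρ : MatrixRep L R K d}

theorem IsBalanced.neg_aInv_le_orderTop (hρ : IsBalanced F ρ) {k : Type*} [Field k] (ι : F →+* k)
    (w : W) (i j : Fin d) : ((-aInv F ρ : Γ) : WithTop Γ) ≤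
      (hahnEmb (Γ := Γ) R K ι (repT ρ w i j)).orderTop :=
  (neg_one_pow_mul_eps_mul_mem_valRing_iff ι 0).mp (by simpa using hρ w i j)

theorem IsBalanced.leadCoeff_eq (hρ : IsBalanced F ρ) (w : W) (i j : Fin d) :
    leadCoeff F ρ w i j = (-1) ^ cs.length w *
      (hahnEmb (Γ := Γ) R K (RingHom.id F) (repT ρ w i j)).coeff (-aInv F ρ) := by
  have hmem := (neg_one_pow_mul_eps_mul_mem_valRing_iff (RingHom.id F) (cs.length w)).mpr
    (hρ.neg_aInv_le_orderTop (RingHom.id F) w i j)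
  rw [leadCoeff, constTerm_eq_coeff hmem, hahnEmb_neg_one_pow_mul_eps_mul,
    HahnSeries.coeff_single_mul, zero_sub]

variable (F ρ) in
/-- The matrix of the leading coefficients `c_{w,λ}^{ij}`. -/
noncomputable def leadMatrix (w : W) : Matrix (Fin d) (Fin d) F :=
  Matrix.of (leadCoeff F ρ w)

theorem sum_leadMatrix_mul_leadMatrix_inv {e : ℕ} {σ : MatrixRep L R K e} (hρ : IsBalanced F ρ)
    (hσ : IsBalanced F σ) (i j : Fin d) (i' j' : Fin e) :
    ∑ w, leadMatrix F ρ w i j * leadMatrix F σ w⁻¹ i' j' =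
      (hahnEmb (Γ := Γ) R K (RingHom.id F) (∑ w, repT ρ w i j * repT σ w⁻¹ i' j')).coeff
        (-aInv F ρ + -aInv F σ) := by
  rw [map_sum, HahnSeries.coeff_sum]
  refine Finset.sum_congr rfl fun w _ => ?_
  have hsign : ((-1) ^ cs.length w : F) * (-1) ^ cs.length w = 1 := by rw [← mul_pow]; simp
  rw [map_mul, coeff_add_mul_of_le_orderTop (hρ.neg_aInv_le_orderTop _ w i j)
    (hσ.neg_aInv_le_orderTop _ w⁻¹ i' j'), leadMatrix, leadMatrix, Matrix.of_apply,
    Matrix.of_apply, hρ.leadCoeff_eq, hσ.leadCoeff_eq, cs.length_inv, mul_mul_mul_comm, hsign,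
    one_mul]

end

theorem SchurRelations.leadMatrix {Λ : Type*} {d : Λ → ℕ} {ρ : ∀ l, MatrixRep L R K (d l)}
    (h : SchurRelations (fun l => schurElement (ρ l)) (fun l => repT (ρ l)))
    (hlow : ∀ l, HasLowestTerm R F (schurElement (ρ l)) (-(2 • aInv F (ρ l))) (fInv F (ρ l)))
    (hbal : ∀ l, IsBalanced F (ρ l)) :
    SchurRelations (fun l => fInv F (ρ l)) (fun l => leadMatrix F (ρ l)) where
  sum_of_ne {l m} hlm i j i' j' := by
    rw [sum_leadMatrix_mul_leadMatrix_inv (hbal l) (hbal m), h.sum_of_ne hlm, map_zero,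
      HahnSeries.coeff_zero]
  sum_self l i j i' j' := by
    rw [sum_leadMatrix_mul_leadMatrix_inv (hbal l) (hbal l), h.sum_self]
    split_ifs
    · rw [← neg_add, ← two_nsmul, (hlow l).coeff_hahnEmb, RingHom.id_apply]
    · rw [map_zero, HahnSeries.coeff_zero]

end LeadingMatrices

variable [IsDomain R] {Λ : Type*} {d : Λ → ℕ} {ρ : ∀ l, MatrixRep L R K (d l)}

variable (F ρ) in
/-- The linear map `t_w ↦ (c_{w,λ})_λ` from `J̃` to a product of matrix algebras, which turns out to
be an isomorphism of algebras. -/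
noncomputable def jRep : (W →₀ F) →ₗ[F] ∀ l, Matrix (Fin (d l)) (Fin (d l)) F :=
  Finsupp.linearCombination F fun w l => leadMatrix F (ρ l) w

theorem jRep_sum_smul_single (a : W → F) (l : Λ) :
    jRep F ρ (∑ w, a w • Finsupp.single w 1) l = ∑ w, a w • leadMatrix F (ρ l) w := by
  simp [jRep]

variable [Fintype Λ]

theorem gammaTilde_eq_sum_trace (x y z : W) : gammaTilde F ρ x y z =
    ∑ l, (fInv F (ρ l))⁻¹ *
      (leadMatrix F (ρ l) x * leadMatrix F (ρ l) y * leadMatrix F (ρ l) z).trace := by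
  refine Finset.sum_congr rfl fun l _ => ?_
  simp only [Matrix.trace, Matrix.diag_apply, Matrix.mul_apply, Finset.mul_sum, leadMatrix,
    Matrix.of_apply, mul_assoc]

theorem nTilde_eq_sum_trace (w : W) :
    nTilde F ρ w = ∑ l, (fInv F (ρ l))⁻¹ * (1 * leadMatrix F (ρ l) w⁻¹).trace := by
  simp only [nTilde, Matrix.one_mul, Matrix.trace, Matrix.diag_apply, Finset.mul_sum, leadMatrix,
    Matrix.of_apply]

theorem jMul_single (x y : W) : jMul F ρ (Finsupp.single x 1) (Finsupp.single y 1) =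
    ∑ z, gammaTilde F ρ x y z⁻¹ • Finsupp.single z 1 := by
  have hsingle (w : W) : (Finsupp.single w 1 : W →₀ F) = Finsupp.basisSingleOne w := by simp
  rw [jMul, hsingle x, Module.Basis.constr_basis, hsingle y, Module.Basis.constr_basis]

theorem jOne_eq_sum : jOne F ρ = ∑ w, nTilde F ρ w • Finsupp.single w 1 := by
  classical
  rw [jOne, Finset.sum_filter_of_ne]
  exact fun w _ => mt fun h => by rw [h, zero_smul]

section

variable (h : SchurRelations (fun l => fInv F (ρ l)) (fun l => leadMatrix F (ρ l)))
  (hf : ∀ l, fInv F (ρ l) ≠ 0)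

include h hf

theorem jRep_jMul (x y : W →₀ F) : jRep F ρ (jMul F ρ x y) = jRep F ρ x * jRep F ρ y := by
  have hmaps : (jMul F ρ).compr₂ (jRep F ρ) =
      (LinearMap.mul F (∀ l, Matrix (Fin (d l)) (Fin (d l)) F)).compl₁₂ (jRep F ρ) (jRep F ρ) := by
    refine Finsupp.basisSingleOne.ext fun x => Finsupp.basisSingleOne.ext fun y =>
      funext fun m => ?_
    have hsingle : ∀ w, jRep F ρ (Finsupp.single w 1) m = leadMatrix F (ρ m) w := by simp [jRep]
    simp only [Finsupp.coe_basisSingleOne, LinearMap.compr₂_apply, LinearMap.compl₁₂_apply,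
      LinearMap.mul_apply', jMul_single, jRep_sum_smul_single, Pi.mul_apply, hsingle,
      gammaTilde_eq_sum_trace]
    exact h.sum_sum_trace_smul_eq hf
      (fun l => leadMatrix F (ρ l) x * leadMatrix F (ρ l) y) m
  exact LinearMap.congr_fun₂ hmaps x y

theorem jRep_jOne : jRep F ρ (jOne F ρ) = 1 := by
  funext m
  simp only [jOne_eq_sum, jRep_sum_smul_single, nTilde_eq_sum_trace]
  exact h.sum_sum_trace_smul_eq hf (fun l => 1) m

omit [Fintype Λ] in
theorem jRep_surjective [Finite Λ] : Function.Surjective (jRep F ρ) := by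
  cases nonempty_fintype Λ
  refine fun X => ⟨∑ w, (∑ l, (fInv F (ρ l))⁻¹ * (X l * leadMatrix F (ρ l) w⁻¹).trace) •
    Finsupp.single w 1, funext fun m => ?_⟩
  rw [jRep_sum_smul_single]
  exact h.sum_sum_trace_smul_eq hf X m

theorem jRep_injective (hd : ∑ l, d l * d l = Fintype.card W) :
    Function.Injective (jRep F ρ) := by
  have hrank : Module.finrank F (W →₀ F) =
      Module.finrank F (∀ l, Matrix (Fin (d l)) (Fin (d l)) F) := by
    rw [Module.finrank_finsupp_self, Module.finrank_pi_fintype, ← hd]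
    simp [Module.finrank_matrix]
  exact (LinearMap.injective_iff_surjective_of_finrank_eq_finrank hrank).mpr
    (jRep_surjective h hf)

theorem jMul_assoc_and_jOne (hd : ∑ l, d l * d l = Fintype.card W) :
    (∀ x y z : W →₀ F, jMul F ρ (jMul F ρ x y) z = jMul F ρ x (jMul F ρ y z)) ∧
      ∀ x : W →₀ F, jMul F ρ (jOne F ρ) x = x ∧ jMul F ρ x (jOne F ρ) = x := by
  have hinj := jRep_injective h hf hd
  refine ⟨fun x y z => hinj ?_, fun x => ⟨hinj ?_, hinj ?_⟩⟩
  · simp only [jRep_jMul h hf, mul_assoc]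
  · rw [jRep_jMul h hf, jRep_jOne h hf, one_mul]
  · rw [jRep_jMul h hf, jRep_jOne h hf, mul_one]

end

end JRing

end IwahoriHecke

theorem proposition3p3_general {B W : Type*} [Group W] [Fintype W] {M : CoxeterMatrix B}
    {cs : CoxeterSystem M W} {Γ : Type*} [AddCommGroup Γ] [LinearOrder Γ] [IsOrderedAddMonoid Γ]
    (L : WeightFunction cs Γ) (R : Subring ℂ)
    (F : Type*) [Field F] [Algebra R F] [IsFractionRing R F]
    (K : Type*) [Field K] [Algebra (AddMonoidAlgebra R Γ) K]
    [IsFractionRing (AddMonoidAlgebra R Γ) K] {Λ : Type*} [Fintype Λ] {d : Λ → ℕ}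
    (E : ∀ l, Representation ℂ W (Fin (d l) → ℂ)) (hE : IsCompleteIrr E)
    (ρ : ∀ l, MatrixRep L R K (d l))
    (hρ : ∀ l, SpecializesTo (R.subtype.comp (theta R).toRingHom) (ρ l) (E l).character)
    (hbal : ∀ l, IsBalanced F (ρ l)) :
    (∀ x y z : W →₀ F, jMul F ρ (jMul F ρ x y) z = jMul F ρ x (jMul F ρ y z)) ∧
      ∀ x : W →₀ F, jMul F ρ (jOne F ρ) x = x ∧ jMul F ρ x (jOne F ρ) = x := by
  have : CharZero R := R.subtype.charZero
  have : CharZero K := charZero_of_injective_ringHom (injective_constants Γ R K)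
  have hsurj := surjective_pi_of_specializesTo ρ (by simp [heckeParam, theta]) hE hρ
  have htrace (l : Λ) (w : W) : (repT (ρ l) w).trace ∈
      Set.range (algebraMap (AddMonoidAlgebra R Γ) K) := (hρ l w).imp fun _ h => h.1
  have hlow (l : Λ) := hasLowestTerm_schurElement (F := F)
    (IsFractionRing.lift (K := F) (g := R.subtype) R.subtype_injective) (ρ l) (hE.dim_ne_zero l)
    (htrace l)
  exact jMul_assoc_and_jOne ((schurRelations_of_surjective hsurj).leadMatrix hlow hbal)
    (fun l => (hlow l).1) (sum_dim_sq hE)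

theorem proposition3p3
    -- a finite Coxeter group `W`, an ordered abelian group `Γ`, a positive weight function `L`
    {B W : Type*} [Group W] [Fintype W] {M : CoxeterMatrix B} (cs : CoxeterSystem M W)
    {Γ : Type*} [AddCommGroup Γ] [LinearOrder Γ] [IsOrderedAddMonoid Γ]
    (L : WeightFunction cs Γ) (hL : ∀ i : B, 0 < L.toFun (cs.simple i))
    -- a subring `R` of `ℂ` containing `2 cos (2π / m_st)`, with `F = Frac R` and `K = Frac R[Γ]`
    (R : Subring ℂ)
    (hR : ∀ i j : B,
      ((2 * Real.cos (2 * Real.pi / orderOf (cs.simple i * cs.simple j)) : ℝ) : ℂ) ∈ R)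
    (F : Type*) [Field F] [Algebra R F] [IsFractionRing R F]
    (K : Type*) [Field K] [Algebra (AddMonoidAlgebra R Γ) K]
    [IsFractionRing (AddMonoidAlgebra R Γ) K]
    -- the irreducible representations of `W`
    {Λ : Type*} [Fintype Λ] {d : Λ → ℕ}
    (E : ∀ l, Representation ℂ W (Fin (d l) → ℂ)) (hE : IsCompleteIrr E)
    -- for each of them, a balanced matrix representation of `H_K` that corresponds to it
    (ρ : ∀ l, MatrixRep L R K (d l)) (hρ : ∀ l, IsAffordedBy (ρ l) (E l))
    (hbal : ∀ l, IsBalanced F (ρ l)) :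
    (∀ x y z : W →₀ F, jMul F ρ (jMul F ρ x y) z = jMul F ρ x (jMul F ρ y z)) ∧
      ∀ x : W →₀ F, jMul F ρ (jOne F ρ) x = x ∧ jMul F ρ x (jOne F ρ) = x :=
  proposition3p3_general L R F K E hE ρ (fun l => (hρ l).2) hbal
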